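/- Let $(C,o)\subset(\mathbb C^2,0)$ be an irreducible plane curve singularity with local algebra $\mathcal O=\mathcal O_{\mathbb C^2,0}/(f)$ ($f$ irreducible) and normalization $n:(\mathbb C,0)\to(C,o)$. Put $\mathfrak v(h)=\operatorname{ord}_t(n^*h)$ for $h\in\mathcal O$, let $\mathcal S=\{\mathfrak v(h) : h\in\mathcal O\}\cap\mathbb N$ be the semigroup of values, and let $\delta=\#(\mathbb N\setminus\mathcal S)$ be the delta invariant. Let $\beta_0<\beta_1<\dots<\beta_g$ be the minimal generating set of $\mathcal S$. Let $w_0(\ell)=2\dim_{\mathbb C}\mathcal O/\{h\in\mathcal O : \mathfrak v(h)\ge \ell\}-\ell$ for $\ell\in\mathbb N$, extend it to $\mathbb R_{\ge 0}$ by $w(x)=\max\{w_0(\lfloor x\rfloor),w_0(\lceil x\rceil)\}$, and put $S_n=\{x\in\mathbb R_{\ge0} : w(x)\le n\}$ for $n\in\mathbb Z$. The lattice cohomology $\mathbb H^0=\bigoplus_{n\in\mathbb Z}\mathbb H^0_{2n}$, $\mathbb H^0_{2n}=H^0(S_n,\mathbb Z)$, is a graded $\mathbb Z[U]$-module, where $U:\mathbb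 H^0_{2n+2}\to\mathbb H^0_{2n}$ is induced by $S_n\subseteq S_{n+1}$. Write $\mathbb H^0_{\ge 2n}=\bigoplus_{k\ge n}\mathbb H^0_{2k}$, let $\mathbb M_{\ge 2n}$ be the $\mathbb Z[U]$-submodule of $\mathbb H^0$ generated by $\mathbb H^0_{\ge 2n}$, and let $T^\infty$ be the $\mathbb Z[U]$-submodule generated by $\bigoplus_{k>0}\mathbb H^0_{2k}$. Let $\mathfrak N$ be the set of integers $n\ge\min w_0$ such that $U$ acts trivially on the image $\mathbb M_{\ge 2n}/(\mathbb M_{\ge 2n}\cap T^\infty)$ of $\mathbb M_{\ge 2n}$ in $\mathbb H^0/T^\infty$. Let $e=\min\mathfrak N$, and let $\mathcal E=\{s\in\mathcal S : w(s)\ge e,\ s\le\delta\}$ be the initial part of the semigroup. **Proposition.** Suppose that $l_{g-1}=\gcd(\beta_0,\dots,\beta_{g-1})=2$ (in particular $g\ge1$). Then the minima $\min w_0$ and $e=\min\mathfrak N$ exist, $\mathcal E=[0,\delta]\cap\mathcal S$, the subgroup $\mathbb H^0_{\ge 2e}$ is closed under the $U$-action, $\mathbb H^0_{\ge 2e}=\mathbb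 H^0$, and $\min w_0\in\mathfrak N$. -/

import Mathlib

open Filter Topology Polynomial
open scoped DirectSum

noncomputable section

/-! ### Germs of holomorphic functions -/

/-- The ring of germs of complex valued functions is a `ℂ`-algebra. -/
instance germAlgebra {α : Type*} (l : Filter α) : Algebra ℂ (Germ l ℂ) :=
  Algebra.ofModule
    (fun r x y => by
      induction x, y using Filter.Germ.inductionOn₂ with
      | _ f g => exact congrArg Germ.ofFun (smul_mul_assoc r f g))
    (fun r x y => by
      induction x, y using Filter.Germ.inductionOn₂ with
      | _ f g => exact congrArg Germ.ofFun (mul_smul_comm r f g))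

/-- The local algebra `𝒪_{E,0}` of germs at the origin of `E` of holomorphic functions. -/
def holoGerm (E : Type*) [NormedAddCommGroup E] [NormedSpace ℂ E] :
    Subalgebra ℂ (Germ (𝓝 (0 : E)) ℂ) where
  carrier := {φ | ∃ F : E → ℂ, AnalyticAt ℂ F 0 ∧ (F : Germ (𝓝 (0 : E)) ℂ) = φ}
  mul_mem' := by
    rintro _ _ ⟨F, hF, rfl⟩ ⟨G, hG, rfl⟩
    exact ⟨F * G, hF.mul hG, rfl⟩
  add_mem' := by
    rintro _ _ ⟨F, hF, rfl⟩ ⟨G, hG, rfl⟩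
    exact ⟨F + G, hF.add hG, rfl⟩
  algebraMap_mem' r := by
    refine ⟨fun _ => r, analyticAt_const, ?_⟩
    rw [Algebra.algebraMap_eq_smul_one]
    change _ = ((r • (1 : E → ℂ) : E → ℂ) : Germ (𝓝 (0 : E)) ℂ)
    congr 1
    ext x
    simp

/-- The order of vanishing `ord_t φ ∈ ℕ ∪ {∞}` of a germ `φ` in one variable. -/
def germOrder (φ : holoGerm ℂ) : ℕ∞ :=
  Germ.liftOn φ.1 (fun F => analyticOrderAt F 0) (fun _ _ h => analyticOrderAt_congr h)

/-- Pull-back `n^* : 𝒪_{ℂ²,0} → 𝒪_{ℂ,0}`, `h ↦ h ∘ n`, along a holomorphic map germ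
`n : (ℂ, 0) → (ℂ², 0)`. -/
def germPullback (n : ℂ → ℂ × ℂ) (hn : AnalyticAt ℂ n 0) (h0 : n 0 = 0) :
    holoGerm (ℂ × ℂ) →ₐ[ℂ] holoGerm ℂ where
  toFun φ := ⟨Germ.compTendsto φ.1 n (by simpa [h0] using hn.continuousAt.tendsto), by
    obtain ⟨_, F, hF, rfl⟩ := φ
    exact ⟨F ∘ n, AnalyticAt.comp (by rwa [h0]) hn, rfl⟩⟩
  map_one' := rfl
  map_mul' := by
    rintro ⟨_, F, hF, rfl⟩ ⟨_, G, hG, rfl⟩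
    rfl
  map_zero' := rfl
  map_add' := by
    rintro ⟨_, F, hF, rfl⟩ ⟨_, G, hG, rfl⟩
    rfl
  commutes' r := by
    apply Subtype.ext
    simp only [Algebra.algebraMap_eq_smul_one]
    rfl

lemma le_germOrder_add {k : ℕ∞} {φ ψ : holoGerm ℂ} (hφ : k ≤ germOrder φ)
    (hψ : k ≤ germOrder ψ) : k ≤ germOrder (φ + ψ) := by
  obtain ⟨_, F, hF, rfl⟩ := φ
  obtain ⟨_, G, hG, rfl⟩ := ψ
  exact (le_min hφ hψ).trans le_analyticOrderAt_add

lemma le_germOrder_mul {k : ℕ∞} (φ : holoGerm ℂ) {ψ : holoGerm ℂ}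
    (hψ : k ≤ germOrder ψ) : k ≤ germOrder (φ * ψ) := by
  obtain ⟨_, F, hF, rfl⟩ := φ
  obtain ⟨_, G, hG, rfl⟩ := ψ
  have h : germOrder (⟨F, F, hF, rfl⟩ * ⟨G, G, hG, rfl⟩) =
      analyticOrderAt F 0 + analyticOrderAt G 0 := analyticOrderAt_mul hF hG
  rw [h]
  exact le_add_left hψ

lemma germOrder_zero : germOrder 0 = ⊤ :=
  analyticOrderAt_eq_top.mpr (Eventually.of_forall fun _ => rfl)

/-! ### Irreducible plane curve singularities -/

/-- An irreducible plane curve singularity `(C, o) ⊂ (ℂ², 0)`, given by an irreducible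
equation germ `f ∈ 𝒪_{ℂ²,0}`, together with its normalization (Puiseux parametrization)
`n : (ℂ, 0) → (C, o)`: a holomorphic map germ which maps injectively into `C = {f = 0}`
(as `C` is an irreducible curve germ, `n` is then onto `C` and is the normalization, and every
normalization is of this form). -/
structure PlaneBranch where
  /-- the local equation of the curve -/
  f : holoGerm (ℂ × ℂ)
  irreducible_f : Irreducible f
  /-- (a representative of) the normalization map -/
  n : ℂ → ℂ × ℂ
  analytic_n : AnalyticAt ℂ n 0
  map_zero_n : n 0 = 0
  pullback_f : germPullback n analytic_n map_zero_n f = 0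
  injective_n : ∃ V ∈ 𝓝 (0 : ℂ), Set.InjOn n V

namespace PlaneBranch

/-- The local algebra `𝒪 = 𝒪_{C,o} = 𝒪_{ℂ²,0} / (f)`. -/
abbrev LocalAlgebra (C : PlaneBranch) : Type := holoGerm (ℂ × ℂ) ⧸ Ideal.span {C.f}

/-- The normalization map on functions, `n^* : 𝒪_{C,o} → 𝒪_{ℂ,0} = ℂ{t}`. -/
def normalization (C : PlaneBranch) : C.LocalAlgebra →ₐ[ℂ] holoGerm ℂ :=
  Ideal.Quotient.liftₐ (Ideal.span {C.f}) (germPullback C.n C.analytic_n C.map_zero_n) (by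
    intro a ha
    obtain ⟨b, rfl⟩ := Ideal.mem_span_singleton'.mp ha
    rw [map_mul, C.pullback_f, mul_zero])

/-- The valuation `𝔳 : 𝒪_{C,o} → ℕ ∪ {∞}`, `h ↦ ord_t (n^* h)`. -/
def val (C : PlaneBranch) (h : C.LocalAlgebra) : ℕ∞ := germOrder (C.normalization h)

/-- The semigroup of values `𝒮_{C,o} = {ord (n^* h) | h ∈ 𝒪_{C,o}} ∩ ℕ`. -/
def semigroup (C : PlaneBranch) : Set ℕ := {k | ∃ h : C.LocalAlgebra, C.val h = k}

/-- The delta invariant `δ(C,o) = #(ℕ ∖ 𝒮_{C,o})`. -/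
def delta (C : PlaneBranch) : ℕ := (C.semigroup)ᶜ.ncard

/-- The valuation filtration `ℱ(ℓ) = {h ∈ 𝒪_{C,o} | 𝔳(h) ≥ ℓ}`. -/
def filtration (C : PlaneBranch) (ℓ : ℕ) : Ideal C.LocalAlgebra where
  carrier := {h | (ℓ : ℕ∞) ≤ C.val h}
  add_mem' {a b} ha hb := by
    change _ ≤ germOrder _
    rw [map_add]
    exact le_germOrder_add ha hb
  zero_mem' := by
    change _ ≤ germOrder _
    rw [map_zero, germOrder_zero]
    exact le_top
  smul_mem' c {a} ha := by
    change _ ≤ germOrder _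
    rw [smul_eq_mul, map_mul]
    exact le_germOrder_mul _ ha

/-- The Hilbert function `𝔥(ℓ) = dim_ℂ 𝒪 / ℱ(ℓ)`. -/
def hilbert (C : PlaneBranch) (ℓ : ℕ) : ℕ :=
  Module.finrank ℂ (C.LocalAlgebra ⧸ C.filtration ℓ)

/-- The weight function `w₀(ℓ) = 2 𝔥(ℓ) - ℓ`. -/
def weight (C : PlaneBranch) (ℓ : ℕ) : ℤ := 2 * (C.hilbert ℓ : ℤ) - (ℓ : ℤ)

end PlaneBranch

/-! ### Minimal generating sets of subsemigroups of `ℕ` -/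

/-- `β₀ < β₁ < ⋯ < β_g` is the increasing enumeration of a minimal generating set of the
additive semigroup (with zero) `S ⊆ ℕ`. -/
structure IsMinimalGenerators (S : Set ℕ) {g : ℕ} (β : Fin (g + 1) → ℕ) : Prop where
  strictMono : StrictMono β
  closure_eq : (AddSubmonoid.closure (Set.range β) : Set ℕ) = S
  minimal : ∀ i, β i ∉ AddSubmonoid.closure (β '' {j | j ≠ i})

/-! ### Lattice cohomology of a weight function on `ℕ` -/

/-- The singular cohomology group `H⁰(X, ℤ)`: singular `0`-cochains (integer valued functions on
the points of `X`) whose coboundary vanishes, i.e. with equal values at the two ends of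
every singular `1`-simplex (path). There are no `0`-coboundaries to divide out. -/
def singularH0 (X : Type*) [TopologicalSpace X] : AddSubgroup (X → ℤ) where
  carrier := {φ | ∀ (x y : X), Path x y → φ y - φ x = 0}
  add_mem' {a b} ha hb x y γ := by
    have h1 := ha x y γ
    have h2 := hb x y γ
    simp only [Pi.add_apply]
    linarith
  zero_mem' _ _ _ := by simp
  neg_mem' {a} ha x y γ := by
    have h1 := ha x y γ
    simp only [Pi.neg_apply]
    linarith

/-- The map `H⁰(B, ℤ) → H⁰(A, ℤ)` induced by an inclusion `A ⊆ B` of spaces. -/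
def singularH0Restrict {Y : Type*} [TopologicalSpace Y] {A B : Set Y} (h : A ⊆ B) :
    singularH0 B →+ singularH0 A where
  toFun φ := ⟨fun x => φ.1 (Set.inclusion h x), fun _ _ γ =>
    φ.2 _ _ (γ.map (continuous_inclusion h))⟩
  map_zero' := rfl
  map_add' _ _ := rfl

namespace LatticeCohomology

/-- The extended weight function: `w(x) = max {w₀(⌊x⌋), w₀(⌈x⌉)}` for `x ∈ ℝ_{≥0}`. -/
def extendedWeight (w₀ : ℕ → ℤ) (x : ℝ) : ℤ := max (w₀ ⌊x⌋₊) (w₀ ⌈x⌉₊)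

/-- The sublevel set `S_n = {x ∈ ℝ_{≥0} | w(x) ≤ n}`. -/
def sublevel (w₀ : ℕ → ℤ) (n : ℤ) : Set ℝ := {x | 0 ≤ x ∧ extendedWeight w₀ x ≤ n}

lemma sublevel_mono (w₀ : ℕ → ℤ) (n : ℤ) : sublevel w₀ (n - 1) ⊆ sublevel w₀ n :=
  fun _ hx => ⟨hx.1, hx.2.trans (by omega)⟩

/-- The homogeneous part `ℍ⁰_{2n} = H⁰(S_n, ℤ)` of degree `2n`. -/
abbrev H0Part (w₀ : ℕ → ℤ) (n : ℤ) : Type := singularH0 (sublevel w₀ n)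

/-- The graded abelian group `ℍ⁰ = ⨁_n ℍ⁰_{2n}`. -/
def H0 (w₀ : ℕ → ℤ) : Type := ⨁ n : ℤ, H0Part w₀ n

instance (w₀ : ℕ → ℤ) : AddCommGroup (H0 w₀) :=
  inferInstanceAs (AddCommGroup (⨁ n : ℤ, H0Part w₀ n))

/-- The component in `ℍ⁰_{2n}` of an element of `ℍ⁰`. -/
def component (w₀ : ℕ → ℤ) (n : ℤ) : H0 w₀ →+ H0Part w₀ n :=
  DFinsupp.evalAddMonoidHom n

/-- The inclusion `ℍ⁰_{2n} → ℍ⁰` of a homogeneous part. -/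
def inclusion (w₀ : ℕ → ℤ) (n : ℤ) : H0Part w₀ n →+ H0 w₀ :=
  DirectSum.of (H0Part w₀) n

/-- The operator `U : ℍ⁰ → ℍ⁰`, given on `ℍ⁰_{2n}` by the restriction `ℍ⁰_{2n} → ℍ⁰_{2n-2}`
along `S_{n-1} ⊆ S_n`. -/
def U (w₀ : ℕ → ℤ) : AddMonoid.End (H0 w₀) :=
  DirectSum.toAddMonoid (β := H0Part w₀) fun n =>
    (inclusion w₀ (n - 1)).comp (singularH0Restrict (sublevel_mono w₀ n))

/-- `ℍ⁰` is a `ℤ[U]`-module: the polynomial variable acts as the operator `U`. -/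
instance (w₀ : ℕ → ℤ) : Module ℤ[X] (H0 w₀) :=
  Module.compHom (H0 w₀) (Polynomial.aeval (R := ℤ) (U w₀)).toRingHom

/-- The graded subgroup `ℍ⁰_{≥ 2n} = ⨁_{k ≥ n} ℍ⁰_{2k}` of `ℍ⁰`. -/
def geq (w₀ : ℕ → ℤ) (n : ℤ) : AddSubgroup (H0 w₀) where
  carrier := {x | ∀ k < n, component w₀ k x = 0}
  add_mem' {a b} ha hb k hk := by rw [map_add, ha k hk, hb k hk, add_zero]
  zero_mem' _ _ := map_zero _
  neg_mem' {a} ha k hk := by rw [map_neg, ha k hk, neg_zero]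

/-- The `ℤ[U]`-submodule `𝕄_{≥ 2n}` of `ℍ⁰` generated by `ℍ⁰_{≥ 2n}`. -/
def M (w₀ : ℕ → ℤ) (n : ℤ) : Submodule ℤ[X] (H0 w₀) :=
  Submodule.span ℤ[X] (geq w₀ n : Set (H0 w₀))

/-- The canonical submodule `T^∞_{2 min w₀}` of `ℍ⁰`: the `ℤ[U]`-submodule generated by
`ℍ⁰_{> 0} = ⨁_{n > 0} ℍ⁰_{2n}`. -/
def T (w₀ : ℕ → ℤ) : Submodule ℤ[X] (H0 w₀) :=
  Submodule.span ℤ[X] (geq w₀ 1 : Set (H0 w₀))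

/-- `min w₀`. -/
def minWeight (w₀ : ℕ → ℤ) : ℤ := sInf (Set.range w₀)

/-- The set `𝔑` of integers `n ≥ min w₀` such that the `U`-action on
`𝕄_{≥ 2n} / T^∞_{2 min w₀}` is trivial. -/
def simpleLevels (w₀ : ℕ → ℤ) : Set ℤ :=
  {n | minWeight w₀ ≤ n ∧
    ∀ q : M w₀ n ⧸ (T w₀).submoduleOf (M w₀ n), (X : ℤ[X]) • q = 0}

/-- `e = min 𝔑`. -/
def e (w₀ : ℕ → ℤ) : ℤ := sInf (simpleLevels w₀)

end LatticeCohomology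

namespace PlaneBranch

/-- The `n`-th initial part `ℰ_n = {s ∈ 𝒮_{C,o} | w(s) ≥ n and s ≤ δ}`. -/
def initialPartAt (C : PlaneBranch) (n : ℤ) : Set ℕ :=
  {s | s ∈ C.semigroup ∧ n ≤ C.weight s ∧ s ≤ C.delta}

/-- The initial part `ℰ = ℰ_e` of the semigroup. -/
def initialPart (C : PlaneBranch) : Set ℕ :=
  C.initialPartAt (LatticeCohomology.e C.weight)

end PlaneBranch

end

noncomputable section

/-! ### Rescaling of power series -/

namespace PowerSeries

variable {K : Type*} [Field K]

/-! Stepping from `ℓ` to `ℓ + 1` raises `w₀` by one if `ℓ` lies in the semigroup and lowers it by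
one otherwise. The key arithmetic fact (`exists_even_below_above`) is that for some `p` all values
below `2p + 1` are even and all even numbers from `2p` on are values. Hence `w₀(ℓ) - (ℓ mod 2)` is
nonincreasing up to `2p` and nondecreasing afterwards, so between two points `w₀` exceeds the larger
end value by at most one. An interval with ends in `S_{n-1}` therefore lies in `S_n`, every class
restricted from `S_n` to `S_{n-1}` is constant, and constants lie in `T^∞`. Thus `U` kills `ℍ⁰/T^∞`,
which makes `min w₀` an element of `𝔑` and so its minimum; the remaining claims follow because `S_n`
is empty for `n < min w₀`.

For the arithmetic fact, parametrize the branch as `(t^m, y(t))` with `m = β₀` even. Injectivity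
forces an odd exponent in `y`; let `k` be the first one, `z₀` the part of `y` below `t^k`, and `q`
the gcd of `m` and the exponents of `z₀`. The conjugates of `z₀` under `t ↦ wt`, `w^m = 1`, are the
roots of a polynomial over the invariant series. Its value at `y` has order `b + k`, where `b` is
the order of its derivative at `z₀`. Polynomials of lower degree have the same order at `y` as at
`z₀`, by Lagrange interpolation, and values at `z₀` are series in `t^q`; division with remainder
then shows that `q` divides every value below `b + k`. Traces of `t^{v-b}` times a cofactor realize
every multiple `v ≥ b` of `q`. Finally `b + k` is odd, so it is at least `β_g`; the other generators
lie below it, so `q` divides their gcd and `q = 2`. -/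

lemma order_le_order_rescale (a : K) (f : PowerSeries K) : f.order ≤ (rescale a f).order :=
  le_order _ _ fun i hi => by rw [coeff_rescale, coeff_of_lt_order i hi, mul_zero]

lemma rescale_comp_apply (a b : K) (f : PowerSeries K) :
    rescale a (rescale b f) = rescale (a * b) f := by
  rw [rescale_rescale, mul_comm]

lemma order_rescale {a : K} (ha : a ≠ 0) (f : PowerSeries K) :
    (rescale a f).order = f.order := by
  refine le_antisymm ?_ (order_le_order_rescale a f)
  have := order_le_order_rescale a⁻¹ (rescale a f)
  rwa [rescale_comp_apply, inv_mul_cancel₀ ha, rescale_one, RingHom.id_apply] at this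

lemma rescale_eq_self_iff {u : K} {q : ℕ} (hu : IsPrimitiveRoot u q) (f : PowerSeries K) :
    rescale u f = f ↔ ∀ j, coeff j f ≠ 0 → q ∣ j := by
  rw [PowerSeries.ext_iff]
  refine forall_congr' fun j => ?_
  rw [coeff_rescale, mul_left_eq_self₀, hu.pow_eq_one_iff_dvd]
  tauto

lemma dvd_of_order_eq {u : K} {q : ℕ} (hu : IsPrimitiveRoot u q) {f : PowerSeries K}
    (hf : rescale u f = f) {v : ℕ} (hv : f.order = v) : q ∣ v :=
  (rescale_eq_self_iff hu f).1 hf v (order_eq_nat.1 hv).1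

lemma lt_order_sum {ι : Type*} (s : Finset ι) (f : ι → PowerSeries K) {a : ℕ∞} (ha : a ≠ ⊤)
    (h : ∀ i ∈ s, a < (f i).order) : a < (∑ i ∈ s, f i).order := by
  refine Finset.sum_induction f (fun g => a < g.order) (fun g g' hg hg' => ?_) ?_ h
  · exact (lt_min hg hg').trans_le (min_order_le_order_add g g')
  · rw [order_zero]; exact ha.lt_top

lemma order_add_of_lt {f g : PowerSeries K} (h : f.order < g.order) :
    (f + g).order = f.order := by
  rw [order_add_of_order_ne _ _ h.ne, min_eq_left h.le]

end PowerSeries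

/-! ### Polynomials over power series and the orbit of a series under rescaling -/

namespace RescaleOrbit

open PowerSeries (rescale)

variable {K : Type*} [Field K]

/-- The values `h(y)`, by order, of polynomials `h` in one variable whose coefficients are
power series invariant under `t ↦ w t`. -/
def orders (w : K) (y : PowerSeries K) : Set ℕ :=
  {v | ∃ h : (PowerSeries K)[X], h.map (rescale w) = h ∧ (h.eval y).order = v}

lemma map_rescale_pow {w : K} {h : (PowerSeries K)[X]} (hh : h.map (rescale w) = h) (i : ℕ) :
    h.map (rescale (w ^ i)) = h := by
  induction i with
  | zero => simp [PowerSeries.rescale_one]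
  | succ i ih =>
    rw [pow_succ', PowerSeries.rescale_mul, ← Polynomial.map_map, hh, ih]

lemma eval_rescale_pow {w : K} {h : (PowerSeries K)[X]} (hh : h.map (rescale w) = h) (i : ℕ)
    (z : PowerSeries K) : h.eval (rescale (w ^ i) z) = rescale (w ^ i) (h.eval z) := by
  conv_lhs => rw [← map_rescale_pow hh i, eval_map_apply]

open scoped Classical in
/-- The orbit of a series under the rescalings by the powers of an `m`-th root of unity. -/
def orbit (w : K) (m : ℕ) (z : PowerSeries K) : Finset (PowerSeries K) :=
  (Finset.range m).image fun i => rescale (w ^ i) z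

variable {w : K} {m : ℕ} {z₀ : PowerSeries K}

lemma mem_orbit {z : PowerSeries K} :
    z ∈ orbit w m z₀ ↔ ∃ i < m, rescale (w ^ i) z₀ = z := by simp [orbit]

lemma rescale_injective (hw : IsPrimitiveRoot w m) (hm : 0 < m) (i : ℕ) :
    Function.Injective (rescale (w ^ i)) :=
  PowerSeries.rescale_injective (pow_ne_zero _ (hw.ne_zero hm.ne'))

lemma self_mem_orbit (hm : 0 < m) : z₀ ∈ orbit w m z₀ :=
  mem_orbit.2 ⟨0, hm, by simp [PowerSeries.rescale_one]⟩

lemma rescale_pow_mem_orbit (hw : IsPrimitiveRoot w m) (hm : 0 < m) (i : ℕ) :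
    rescale (w ^ i) z₀ ∈ orbit w m z₀ :=
  mem_orbit.2 ⟨i % m, Nat.mod_lt _ hm, by rw [hw.eq_orderOf, pow_mod_orderOf]⟩

open scoped Classical in
lemma image_orbit (hw : IsPrimitiveRoot w m) (hm : 0 < m) (i : ℕ) :
    (orbit w m z₀).image (rescale (w ^ i)) = orbit w m z₀ := by
  refine Finset.eq_of_subset_of_card_le ?_ ?_
  · intro z hz
    obtain ⟨z', hz', rfl⟩ := Finset.mem_image.1 hz
    obtain ⟨j, -, rfl⟩ := mem_orbit.1 hz'
    rw [PowerSeries.rescale_comp_apply, ← pow_add]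
    exact rescale_pow_mem_orbit hw hm _
  · rw [Finset.card_image_of_injective _ (rescale_injective hw hm i)]

open scoped Classical in
/-- `∏ (Y - z')` over the elements `z' ≠ z` of the orbit. -/
def cofactor (w : K) (m : ℕ) (z₀ z : PowerSeries K) : (PowerSeries K)[X] :=
  ∏ z' ∈ (orbit w m z₀).erase z, (X - C z')

/-- `∏ (Y - z)` over the elements `z` of the orbit. -/
def orbitPoly (w : K) (m : ℕ) (z₀ : PowerSeries K) : (PowerSeries K)[X] :=
  ∏ z ∈ orbit w m z₀, (X - C z)

lemma orbitPoly_monic : (orbitPoly w m z₀).Monic := monic_prod_of_monic _ _ fun _ _ => monic_X_sub_C _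

lemma degree_orbitPoly : (orbitPoly w m z₀).degree = (orbit w m z₀).card := by
  simp [orbitPoly, degree_prod]

lemma mul_cofactor {z : PowerSeries K} (hz : z ∈ orbit w m z₀) :
    (X - C z) * cofactor w m z₀ z = orbitPoly w m z₀ := by
  classical
  rw [cofactor, orbitPoly, ← Finset.mul_prod_erase _ (fun z => X - C z) hz]

lemma degree_cofactor_lt {z : PowerSeries K} (hz : z ∈ orbit w m z₀) :
    (cofactor w m z₀ z).degree < (orbit w m z₀).card := by
  classical
  rw [cofactor, degree_prod]
  simp only [degree_X_sub_C, Finset.sum_const, nsmul_eq_mul, mul_one]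
  exact_mod_cast Finset.card_erase_lt_of_mem hz

lemma eval_cofactor_of_ne {z z' : PowerSeries K} (hz' : z' ∈ orbit w m z₀) (h : z' ≠ z) :
    (cofactor w m z₀ z).eval z' = 0 := by
  classical
  rw [cofactor, eval_prod]
  exact Finset.prod_eq_zero (Finset.mem_erase.2 ⟨h, hz'⟩) (by simp)

lemma map_cofactor (hw : IsPrimitiveRoot w m) (hm : 0 < m) (i : ℕ) (z : PowerSeries K) :
    (cofactor w m z₀ z).map (rescale (w ^ i)) = cofactor w m z₀ (rescale (w ^ i) z) := by
  classical
  conv_rhs => rw [cofactor, ← image_orbit hw hm i,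
    ← Finset.image_erase (rescale_injective hw hm i),
    Finset.prod_image ((rescale_injective hw hm i).injOn)]
  simp [cofactor, Polynomial.map_prod]

lemma map_orbitPoly (hw : IsPrimitiveRoot w m) (hm : 0 < m) :
    (orbitPoly w m z₀).map (rescale w) = orbitPoly w m z₀ := by
  classical
  have h := image_orbit (z₀ := z₀) hw hm 1
  have hi := rescale_injective hw hm 1
  rw [pow_one] at h hi
  conv_rhs => rw [orbitPoly, ← h, Finset.prod_image hi.injOn]
  simp [orbitPoly, Polynomial.map_prod]

/-- A series `y` is approximated to order `k` by `z₀`, and `z₀` is closer to `y` than every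
other element of its orbit. -/
structure Approx (w : K) (m : ℕ) (z₀ y : PowerSeries K) (k : ℕ) : Prop where
  primitive : IsPrimitiveRoot w m
  pos : 0 < m
  order_sub : (y - z₀).order = k
  order_lt : ∀ z ∈ orbit w m z₀, z ≠ z₀ → (z₀ - z).order < k

/-! ### Values of invariant polynomials at `y` compared with those at `z₀`. -/

namespace Approx

variable {y : PowerSeries K} {k : ℕ} (A : Approx w m z₀ y k)
include A

lemma self_mem : z₀ ∈ orbit w m z₀ := self_mem_orbit A.pos

lemma pow_ne_zero (i : ℕ) : w ^ i ≠ 0 := _root_.pow_ne_zero _ (A.primitive.ne_zero A.pos.ne')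

/-- In `y - z = (z₀ - z) + (y - z₀)` the second summand has strictly larger order. -/
lemma order_sub_of_ne {z : PowerSeries K} (hz : z ∈ orbit w m z₀) (hne : z ≠ z₀) :
    (y - z).order = (z₀ - z).order := by
  have h := A.order_lt z hz hne
  rw [← A.order_sub] at h
  rw [← PowerSeries.order_add_of_lt h]
  congr 1
  ring

lemma order_eval_cofactor :
    ((cofactor w m z₀ z₀).eval y).order = ((cofactor w m z₀ z₀).eval z₀).order := by
  classical
  simp only [cofactor, eval_prod, PowerSeries.order_prod, eval_sub, eval_X, eval_C]
  exact Finset.sum_congr rfl fun z hz =>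
    A.order_sub_of_ne (Finset.mem_of_mem_erase hz) (Finset.ne_of_mem_erase hz)

omit A in
lemma eval_cofactor_ne_zero : (cofactor w m z₀ z₀).eval z₀ ≠ 0 := by
  classical
  rw [cofactor, eval_prod]
  refine Finset.prod_ne_zero_iff.2 fun z hz => ?_
  simpa [sub_eq_zero] using (Finset.ne_of_mem_erase hz).symm

omit A in
lemma order_eval_cofactor_ne_top : ((cofactor w m z₀ z₀).eval z₀).order ≠ ⊤ := by
  rw [Ne, PowerSeries.order_eq_top]
  exact eval_cofactor_ne_zero

lemma order_eval_cofactor_self {z : PowerSeries K} (hz : z ∈ orbit w m z₀) :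
    ((cofactor w m z₀ z).eval z).order = ((cofactor w m z₀ z₀).eval z₀).order := by
  obtain ⟨i, -, rfl⟩ := mem_orbit.1 hz
  rw [← map_cofactor A.primitive A.pos, eval_map_apply, PowerSeries.order_rescale (A.pow_ne_zero i)]

lemma order_eval_orbitPoly :
    ((orbitPoly w m z₀).eval y).order = k + ((cofactor w m z₀ z₀).eval z₀).order := by
  rw [← mul_cofactor A.self_mem, eval_mul, PowerSeries.order_mul, A.order_eval_cofactor]
  simp [A.order_sub]

/-- The products `(y - z) · cofactor_z(y)` agree for all `z` in the orbit. Since `y` is closer to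
`z₀` than to `z`, the complementary factor must vanish to higher order. -/
lemma lt_order_eval_cofactor {z : PowerSeries K} (hz : z ∈ orbit w m z₀) (hne : z ≠ z₀) :
    ((cofactor w m z₀ z₀).eval z₀).order < ((cofactor w m z₀ z).eval y).order := by
  have h1 := A.order_eval_orbitPoly
  rw [← mul_cofactor hz, eval_mul, PowerSeries.order_mul] at h1
  simp only [eval_sub, eval_X, eval_C, A.order_sub_of_ne hz hne] at h1
  have h2 := A.order_lt z hz hne
  by_contra! h3
  have h4 : (z₀ - z).order + ((cofactor w m z₀ z).eval y).order <
      k + ((cofactor w m z₀ z₀).eval z₀).order :=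
    ENat.add_lt_add_of_lt_of_le
      (ne_top_of_le_ne_top order_eval_cofactor_ne_top h3) h2 h3
  exact h4.ne h1

/-- The order at `y` of a combination of the cofactors is determined by the term of `z₀`. -/
lemma order_sum_cofactor {c : PowerSeries K → PowerSeries K} (h0 : c z₀ ≠ 0)
    (hc : ∀ z ∈ orbit w m z₀, (c z₀).order ≤ (c z).order) :
    ((∑ z ∈ orbit w m z₀, C (c z) * cofactor w m z₀ z).eval y).order =
      (c z₀).order + ((cofactor w m z₀ z₀).eval z₀).order := by
  classical
  have h0' : (c z₀).order ≠ ⊤ := by rwa [Ne, PowerSeries.order_eq_top]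
  have h1 : (c z₀ * (cofactor w m z₀ z₀).eval y).order =
      (c z₀).order + ((cofactor w m z₀ z₀).eval z₀).order := by
    rw [PowerSeries.order_mul, A.order_eval_cofactor]
  rw [eval_finsetSum, ← Finset.add_sum_erase _ _ A.self_mem, PowerSeries.order_add_of_lt]
  · rw [eval_mul, eval_C, h1]
  · rw [eval_mul, eval_C, h1]
    refine PowerSeries.lt_order_sum _ _ ?_ fun z hz => ?_
    · exact WithTop.add_ne_top.2 ⟨h0', order_eval_cofactor_ne_top⟩
    · obtain ⟨hne, hz⟩ := Finset.mem_erase.1 hz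
      rw [eval_mul, eval_C, PowerSeries.order_mul]
      exact ENat.add_lt_add_of_le_of_lt h0' (hc z hz) (A.lt_order_eval_cofactor hz hne)

omit A in
open scoped Classical in
-- Interpolation on the orbit, with the denominators `cofactor_z(z)` cleared because the
-- coefficients form only a ring.
lemma lagrange {h : (PowerSeries K)[X]} (hd : h.degree < (orbitPoly w m z₀).degree) :
    C (∏ z ∈ orbit w m z₀, (cofactor w m z₀ z).eval z) * h =
      ∑ z ∈ orbit w m z₀, C (h.eval z *
        ∏ z' ∈ (orbit w m z₀).erase z, (cofactor w m z₀ z').eval z') * cofactor w m z₀ z := by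
  rw [degree_orbitPoly] at hd
  refine eq_of_degrees_lt_of_eval_finset_eq (orbit w m z₀) ?_ ?_ fun z hz => ?_
  · refine (degree_mul_le _ _).trans_lt ?_
    refine lt_of_le_of_lt ?_ hd
    exact (add_le_add_left degree_C_le _).trans (by simp)
  · refine (degree_sum_le _ _).trans_lt ?_
    rw [Finset.sup_lt_iff (by exact WithBot.bot_lt_coe _)]
    intro z hz
    refine (degree_mul_le _ _).trans_lt (lt_of_le_of_lt ?_ (degree_cofactor_lt hz))
    exact (add_le_add_left degree_C_le _).trans (by simp)
  · rw [eval_finsetSum, Finset.sum_eq_single_of_mem z hz]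
    · simp only [eval_mul, eval_C]
      rw [← Finset.mul_prod_erase _ _ hz]
      ring
    · intro z' _ hne
      rw [eval_mul, eval_cofactor_of_ne hz hne.symm, mul_zero]

/-- A polynomial with invariant coefficients and of lower degree than the minimal polynomial of
`z₀` has the same order at `y` and at `z₀`. -/
lemma order_eval {h : (PowerSeries K)[X]} (hh : h.map (rescale w) = h)
    (hd : h.degree < (orbitPoly w m z₀).degree) : (h.eval y).order = (h.eval z₀).order := by
  classical
  -- Invariance of `h` makes its values on the orbit conjugate to each other, so no coefficient in
  -- the interpolation formula has smaller order than the one at `z₀`.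
  have ho : ∀ z ∈ orbit w m z₀, (h.eval z).order = (h.eval z₀).order := by
    intro z hz
    obtain ⟨i, -, rfl⟩ := mem_orbit.1 hz
    rw [eval_rescale_pow hh, PowerSeries.order_rescale (A.pow_ne_zero i)]
  by_cases h0 : h.eval z₀ = 0
  · have : h = 0 := by
      refine eq_zero_of_degree_lt_of_eval_finset_eq_zero (orbit w m z₀)
        (by rwa [degree_orbitPoly] at hd) fun z hz => ?_
      rw [← PowerSeries.order_eq_top, ho z hz, PowerSeries.order_eq_top, h0]
    simp [this]
  set E : PowerSeries K → PowerSeries K := fun z => (cofactor w m z₀ z).eval z with hE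
  have hprod : ∀ z ∈ orbit w m z₀, (∏ z' ∈ (orbit w m z₀).erase z, E z').order =
      ((orbit w m z₀).card - 1) • (E z₀).order := by
    intro z hz
    rw [PowerSeries.order_prod, ← Finset.card_erase_of_mem hz]
    exact Finset.sum_eq_card_nsmul fun z' hz' =>
      A.order_eval_cofactor_self (Finset.mem_of_mem_erase hz')
  have hne : ∏ z' ∈ (orbit w m z₀).erase z₀, E z' ≠ 0 := by
    refine Finset.prod_ne_zero_iff.2 fun z hz => ?_
    rw [Ne, ← PowerSeries.order_eq_top, hE, A.order_eval_cofactor_self (Finset.mem_of_mem_erase hz)]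
    exact order_eval_cofactor_ne_top
  have key := congrArg (fun p => (p.eval y).order) (lagrange hd)
  simp only at key
  rw [A.order_sum_cofactor (c := fun z => h.eval z * ∏ z' ∈ (orbit w m z₀).erase z, E z')
    (mul_ne_zero h0 hne), eval_mul, eval_C,
    ← Finset.mul_prod_erase _ _ A.self_mem, PowerSeries.order_mul, PowerSeries.order_mul,
    PowerSeries.order_mul] at key
  · have h1 : (E z₀).order + (∏ z' ∈ (orbit w m z₀).erase z₀, E z').order ≠ ⊤ := by
      rw [← PowerSeries.order_mul, Ne, PowerSeries.order_eq_top]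
      exact mul_ne_zero eval_cofactor_ne_zero hne
    refine (ENat.add_right_injective_of_ne_top h1) (key.trans ?_)
    ring
  · intro z hz
    rw [PowerSeries.order_mul, PowerSeries.order_mul, ho z hz, hprod z hz, hprod z₀ A.self_mem]

/-- The structure of the orders below and above the order of `orbitPoly` at `y`. -/
theorem exists_orders {u : K} {q : ℕ} (hu : IsPrimitiveRoot u q) {n : ℕ} (hun : u = w ^ n)
    (hz : rescale u z₀ = z₀)
    (hstab : ∀ i j, rescale (w ^ i) z₀ = rescale (w ^ j) z₀ → w ^ (i * q) = w ^ (j * q)) :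
    ∃ b, q ∣ b ∧ b + k ∈ orders w y ∧ (∀ v ∈ orders w y, v < b + k → q ∣ v) ∧
      ∀ v, b ≤ v → q ∣ v → v ∈ orders w y := by
  classical
  -- `b` is the order at `z₀` of the derivative of `orbitPoly`.
  obtain ⟨b, hb⟩ := ENat.ne_top_iff_exists.1
    (order_eval_cofactor_ne_top (w := w) (m := m) (z₀ := z₀))
  have hqb : q ∣ b := by
    refine PowerSeries.dvd_of_order_eq hu (f := (cofactor w m z₀ z₀).eval z₀) ?_ hb.symm
    have := map_cofactor (z₀ := z₀) A.primitive A.pos n z₀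
    rw [← hun, hz] at this
    have h1 := eval_map_apply (rescale u) (p := cofactor w m z₀ z₀) z₀
    rw [hz, this] at h1
    exact h1.symm
  refine ⟨b, hqb, ⟨orbitPoly w m z₀, map_orbitPoly A.primitive A.pos, ?_⟩, ?_, ?_⟩
  · rw [A.order_eval_orbitPoly, ← hb, add_comm]; rfl
  · rintro v ⟨h, hh, hv⟩ hlt
    -- The subtracted multiple of `orbitPoly` has order at least `b + k > v` at `y`, so the
    -- remainder still has order `v` there, and by `order_eval` also at `z₀`.
    have hr : (h %ₘ orbitPoly w m z₀).map (rescale w) = h %ₘ orbitPoly w m z₀ := by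
      rw [map_modByMonic _ orbitPoly_monic, hh, map_orbitPoly A.primitive A.pos]
    have hr' := A.order_eval hr (degree_modByMonic_lt _ orbitPoly_monic)
    have hsum : (h %ₘ orbitPoly w m z₀).eval y = h.eval y +
        -((orbitPoly w m z₀).eval y * (h /ₘ orbitPoly w m z₀).eval y) := by
      conv_rhs => rw [← eval_mul, ← sub_eq_add_neg, ← eval_sub]
      rw [modByMonic_eq_sub_mul_div]
    have hlt' : (h.eval y).order <
        (-((orbitPoly w m z₀).eval y * (h /ₘ orbitPoly w m z₀).eval y)).order := by
      rw [PowerSeries.order_neg, PowerSeries.order_mul, A.order_eval_orbitPoly, ← hb, hv]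
      refine lt_of_lt_of_le ?_ le_self_add
      rw [add_comm]
      exact_mod_cast hlt
    have ho : ((h %ₘ orbitPoly w m z₀).eval z₀).order = v := by
      rw [← hr', hsum, PowerSeries.order_add_of_lt hlt', hv]
    refine PowerSeries.dvd_of_order_eq hu ?_ ho
    have := eval_rescale_pow hr n z₀
    rw [← hun, hz] at this
    exact this.symm
  · intro v hv hqv
    obtain ⟨p, rfl⟩ := Nat.exists_eq_add_of_le hv
    have hqp : q ∣ p := (Nat.dvd_add_right hqb).1 hqv
    choose! i _ hi using fun z (hz : z ∈ orbit w m z₀) => mem_orbit.1 hz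
    -- `c z` is the conjugate of `t^p` matching `z`. The choice of the power of `w` is immaterial:
    -- by `hstab`, powers giving the same `z` agree on `t^q`, and `q ∣ p`. The sum of `c z *
    -- cofactor z` is thus a trace, hence invariant.
    set c : PowerSeries K → PowerSeries K := fun z => rescale (w ^ i z) (PowerSeries.X ^ p) with hc
    have hcx : ∀ j, rescale (w ^ j) ((PowerSeries.X : PowerSeries K) ^ p) =
        PowerSeries.C (w ^ (j * p)) * PowerSeries.X ^ p := by
      intro j
      rw [map_pow, PowerSeries.rescale_X, mul_pow, ← map_pow, ← pow_mul]
    have hco : ∀ z, (c z).order = p := fun z => by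
      rw [hc, PowerSeries.order_rescale (A.pow_ne_zero _), PowerSeries.order_X_pow]
    have hcs : ∀ z ∈ orbit w m z₀, rescale w (c z) = c (rescale w z) := by
      intro z hz
      have hz' : rescale w z ∈ orbit w m z₀ := by
        obtain ⟨j, -, rfl⟩ := mem_orbit.1 hz
        rw [PowerSeries.rescale_comp_apply, ← pow_succ']
        exact rescale_pow_mem_orbit A.primitive A.pos _
      have h1 := hstab (i z + 1) (i (rescale w z)) (by
        rw [hi _ hz', pow_succ', ← PowerSeries.rescale_comp_apply, hi z hz])
      rw [hc]
      simp only
      rw [PowerSeries.rescale_comp_apply, ← pow_succ', hcx, hcx]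
      obtain ⟨r, rfl⟩ := hqp
      rw [← mul_assoc, ← mul_assoc, pow_mul _ _ r, h1, ← pow_mul]
    refine ⟨∑ z ∈ orbit w m z₀, C (c z) * cofactor w m z₀ z, ?_, ?_⟩
    · have h1 := image_orbit (z₀ := z₀) A.primitive A.pos 1
      have h2 := rescale_injective A.primitive A.pos 1
      have h3 := map_cofactor (z₀ := z₀) A.primitive A.pos 1
      rw [pow_one] at h1 h2 h3
      conv_rhs => rw [← h1, Finset.sum_image h2.injOn]
      rw [Polynomial.map_sum]
      refine Finset.sum_congr rfl fun z hz => ?_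
      rw [Polynomial.map_mul, Polynomial.map_C, hcs z hz, h3]
    · rw [A.order_sum_cofactor, hco, ← hb]
      · push_cast; ring
      · rw [Ne, ← PowerSeries.order_eq_top, hco]; exact ENat.natCast_ne_top _
      · intro z _; rw [hco, hco]

end Approx
end RescaleOrbit

/-! ### Weight functions that first decrease and then increase, up to jumps by one -/

namespace LatticeCohomology

/-- Between two points of a sublevel set the weight exceeds the level by at most one. -/
def AlmostUnimodal (w₀ : ℕ → ℤ) : Prop :=
  ∀ a x b, a ≤ x → x ≤ b → w₀ x ≤ max (w₀ a) (w₀ b) + 1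

section Semigroup

variable {w₀ : ℕ → ℤ} {S : Set ℕ} {p : ℕ}

lemma sub_parity_antitone (hnot : ∀ l, l ∉ S → w₀ (l + 1) = w₀ l - 1)
    (hmem : ∀ l, l ∈ S → w₀ (l + 1) = w₀ l + 1) (hodd : ∀ l ∈ S, l < 2 * p + 1 → Even l)
    {a x : ℕ} (hax : a ≤ x) (hx : x ≤ 2 * p) : w₀ x - (x % 2 : ℕ) ≤ w₀ a - (a % 2 : ℕ) := by
  induction x, hax using Nat.le_induction with
  | base => exact le_rfl
  | succ l _ ih =>
    have ih := ih (by omega)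
    by_cases hl : l ∈ S
    · obtain ⟨i, rfl⟩ := hodd l hl (by omega)
      have := hmem _ hl
      omega
    · have := hnot _ hl
      omega

lemma sub_parity_monotone (hnot : ∀ l, l ∉ S → w₀ (l + 1) = w₀ l - 1)
    (hmem : ∀ l, l ∈ S → w₀ (l + 1) = w₀ l + 1) (heven : ∀ l, 2 * p ≤ l → Even l → l ∈ S)
    {x b : ℕ} (hx : 2 * p ≤ x) (hxb : x ≤ b) : w₀ x - (x % 2 : ℕ) ≤ w₀ b - (b % 2 : ℕ) := by
  induction b, hxb using Nat.le_induction with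
  | base => exact le_rfl
  | succ l hl' ih =>
    by_cases hl : l ∈ S
    · have := hmem _ hl
      omega
    · have := hnot _ hl
      have : ¬ Even l := fun h => hl (heven l (by omega) h)
      rw [Nat.even_iff] at this
      omega

/-- The parity correction is 0 or 1, which accounts for the `+ 1`: compare with `a` to the left of
`2p`, with `b` to the right. -/
theorem almostUnimodal_of_semigroup (hnot : ∀ l, l ∉ S → w₀ (l + 1) = w₀ l - 1)
    (hmem : ∀ l, l ∈ S → w₀ (l + 1) = w₀ l + 1) (hodd : ∀ l ∈ S, l < 2 * p + 1 → Even l)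
    (heven : ∀ l, 2 * p ≤ l → Even l → l ∈ S) : AlmostUnimodal w₀ := by
  intro a x b hax hxb
  rcases le_total x (2 * p) with h | h
  · have := sub_parity_antitone hnot hmem hodd hax h
    omega
  · have := sub_parity_monotone hnot hmem heven h hxb
    omega

theorem bddBelow_of_semigroup (hnot : ∀ l, l ∉ S → w₀ (l + 1) = w₀ l - 1)
    (hmem : ∀ l, l ∈ S → w₀ (l + 1) = w₀ l + 1) (hodd : ∀ l ∈ S, l < 2 * p + 1 → Even l)
    (heven : ∀ l, 2 * p ≤ l → Even l → l ∈ S) : BddBelow (Set.range w₀) := by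
  refine ⟨w₀ (2 * p), ?_⟩
  rintro _ ⟨x, rfl⟩
  rcases le_total x (2 * p) with h | h
  · have := sub_parity_antitone hnot hmem hodd h le_rfl
    omega
  · have := sub_parity_monotone hnot hmem heven le_rfl h
    omega

end Semigroup

/-! ### Lattice cohomology of an almost unimodal weight function -/

variable {w₀ : ℕ → ℤ}

lemma AlmostUnimodal.Icc_subset_sublevel (h : AlmostUnimodal w₀) {n : ℤ} {a b : ℝ}
    (ha : a ∈ sublevel w₀ (n - 1)) (hb : b ∈ sublevel w₀ (n - 1)) :
    Set.Icc a b ⊆ sublevel w₀ n := by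
  rintro x ⟨hax, hxb⟩
  obtain ⟨ha0, ha⟩ := ha
  obtain ⟨-, hb⟩ := hb
  -- The extended weight is a maximum over floor and ceiling, both monotone, so the bound is used
  -- once for each.
  have h1 := h _ _ _ (Nat.floor_mono hax) (Nat.floor_mono hxb)
  have h2 := h _ _ _ (Nat.ceil_mono hax) (Nat.ceil_mono hxb)
  unfold extendedWeight at ha hb
  refine ⟨ha0.trans hax, ?_⟩
  unfold extendedWeight
  omega

lemma AlmostUnimodal.eq_of_mem_sublevel (h : AlmostUnimodal w₀) {n : ℤ} (φ : H0Part w₀ n)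
    {a b : ℝ} (ha : a ∈ sublevel w₀ (n - 1)) (hb : b ∈ sublevel w₀ (n - 1)) :
    φ.1 ⟨a, sublevel_mono w₀ n ha⟩ = φ.1 ⟨b, sublevel_mono w₀ n hb⟩ := by
  wlog hab : a ≤ b generalizing a b
  · exact (this hb ha (le_of_not_ge hab)).symm
  have hsub := h.Icc_subset_sublevel ha hb
  have hp : IsPathConnected (Set.Icc a b) := (convex_Icc a b).isPathConnected ⟨a, le_rfl, hab⟩
  obtain ⟨γ, hγ⟩ := hp.joinedIn a ⟨le_rfl, hab⟩ b ⟨hab, le_rfl⟩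
  have := φ.2 _ _ ((JoinedIn.joined_subtype ⟨γ, fun t => hsub (hγ t)⟩).somePath)
  omega

/-- The constant `0`-cocycle. -/
def constPart (w₀ : ℕ → ℤ) (n c : ℤ) : H0Part w₀ n := ⟨fun _ => c, fun _ _ _ => sub_self c⟩

lemma X_smul (x : H0 w₀) : (X : ℤ[X]) • x = U w₀ x := by
  change aeval (U w₀) X x = _
  rw [aeval_X]

lemma U_inclusion (n : ℤ) (φ : H0Part w₀ n) :
    U w₀ (inclusion w₀ n φ) =
      inclusion w₀ (n - 1) (singularH0Restrict (sublevel_mono w₀ n) φ) := by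
  unfold U inclusion
  erw [DirectSum.toAddMonoid_of]
  rfl

lemma inclusion_mem_geq {m n : ℤ} (h : m ≤ n) (φ : H0Part w₀ n) :
    inclusion w₀ n φ ∈ geq w₀ m := fun k hk => by
  exact DirectSum.of_eq_of_ne _ _ _ (by omega)

/-- `U` carries a constant to the same constant one level down, so all constants descend from
positive degree. -/
lemma inclusion_constPart_mem_T (n c : ℤ) : inclusion w₀ n (constPart w₀ n c) ∈ T w₀ := by
  rcases le_total 1 n with h | h
  · exact Submodule.subset_span (inclusion_mem_geq h _)
  · induction n, h using Int.leInductionDown with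
    | base => exact Submodule.subset_span (inclusion_mem_geq le_rfl _)
    | pred n _ ih =>
      have := (T w₀).smul_mem (X : ℤ[X]) ih
      rw [X_smul, U_inclusion] at this
      exact this

theorem AlmostUnimodal.U_mem_T (h : AlmostUnimodal w₀) (x : H0 w₀) : U w₀ x ∈ T w₀ := by
  induction x using DirectSum.induction_on with
  | zero => exact (map_zero (U w₀)).symm ▸ zero_mem (T w₀)
  | add x y hx hy => exact (map_add (U w₀) x y).symm ▸ add_mem hx hy
  | of n φ =>
    change U w₀ (inclusion w₀ n φ) ∈ T w₀
    rw [U_inclusion]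
    have : ∃ c, singularH0Restrict (sublevel_mono w₀ n) φ = constPart w₀ (n - 1) c := by
      rcases (sublevel w₀ (n - 1)).eq_empty_or_nonempty with he | ⟨a, ha⟩
      · exact ⟨0, Subtype.ext (funext fun x => (Set.eq_empty_iff_forall_notMem.1 he _ x.2).elim)⟩
      · exact ⟨φ.1 ⟨a, sublevel_mono w₀ n ha⟩,
          Subtype.ext (funext fun x => h.eq_of_mem_sublevel φ x.2 ha)⟩
    obtain ⟨c, hc⟩ := this
    rw [hc]
    exact inclusion_constPart_mem_T _ _

theorem isLeast_minWeight (hb : BddBelow (Set.range w₀)) :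
    IsLeast (Set.range w₀) (minWeight w₀) :=
  ⟨Int.csInf_mem (Set.range_nonempty _) hb, fun _ hx => csInf_le hb hx⟩

theorem AlmostUnimodal.minWeight_mem_simpleLevels (h : AlmostUnimodal w₀) :
    minWeight w₀ ∈ simpleLevels w₀ := by
  refine ⟨le_rfl, fun q => ?_⟩
  obtain ⟨z, rfl⟩ := Submodule.Quotient.mk_surjective _ q
  rw [← Submodule.Quotient.mk_smul, Submodule.Quotient.mk_eq_zero]
  change (X : ℤ[X]) • (z : H0 w₀) ∈ T w₀
  rw [X_smul]
  exact h.U_mem_T _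

theorem AlmostUnimodal.isLeast_simpleLevels (h : AlmostUnimodal w₀) :
    IsLeast (simpleLevels w₀) (minWeight w₀) :=
  ⟨h.minWeight_mem_simpleLevels, fun _ hn => hn.1⟩

theorem AlmostUnimodal.e_eq_minWeight (h : AlmostUnimodal w₀) : e w₀ = minWeight w₀ :=
  h.isLeast_simpleLevels.csInf_eq

/-- Sublevel sets below the minimum are empty and have zero cohomology. -/
theorem geq_minWeight (hb : BddBelow (Set.range w₀)) : geq w₀ (minWeight w₀) = ⊤ := by
  refine eq_top_iff.2 fun x _ k hk => ?_
  refine Subtype.ext (funext fun y => ?_)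
  have h1 := (isLeast_minWeight hb).2 ⟨⌊(y : ℝ)⌋₊, rfl⟩
  have h2 := (le_max_left _ _).trans y.2.2
  omega

end LatticeCohomology

/-! ### Taylor series at the origin -/

/-- The Taylor series at the origin of a function of one complex variable. -/
def taylorSeries (f : ℂ → ℂ) : PowerSeries ℂ :=
  PowerSeries.mk fun n => iteratedDeriv n f 0 / (n.factorial : ℂ)

namespace taylorSeries

lemma coeff (f : ℂ → ℂ) (n : ℕ) :
    PowerSeries.coeff n (taylorSeries f) = iteratedDeriv n f 0 / (n.factorial : ℂ) :=
  PowerSeries.coeff_mk _ _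

lemma congr {f g : ℂ → ℂ} (h : f =ᶠ[𝓝 0] g) : taylorSeries f = taylorSeries g := by
  ext n
  rw [coeff, coeff, h.iteratedDeriv_eq n]

lemma add {f g : ℂ → ℂ} (hf : AnalyticAt ℂ f 0) (hg : AnalyticAt ℂ g 0) :
    taylorSeries (f + g) = taylorSeries f + taylorSeries g := by
  ext n
  rw [map_add, coeff, coeff, coeff, iteratedDeriv_add hf.contDiffAt hg.contDiffAt, add_div]

lemma smul (c : ℂ) (f : ℂ → ℂ) : taylorSeries (c • f) = c • taylorSeries f := by
  ext n
  rw [PowerSeries.coeff_smul, coeff, coeff, iteratedDeriv_const_smul_field, smul_eq_mul,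
    smul_eq_mul, mul_div_assoc]

lemma mul {f g : ℂ → ℂ} (hf : AnalyticAt ℂ f 0) (hg : AnalyticAt ℂ g 0) :
    taylorSeries (f * g) = taylorSeries f * taylorSeries g := by
  ext n
  rw [PowerSeries.coeff_mul, coeff, iteratedDeriv_mul hf.contDiffAt hg.contDiffAt,
    Finset.Nat.sum_antidiagonal_eq_sum_range_succ_mk, Finset.sum_div]
  refine Finset.sum_congr rfl fun i hi => ?_
  rw [coeff, coeff, Nat.cast_choose ℂ (by simpa [Nat.lt_succ_iff] using hi)]
  have h1 : (n.factorial : ℂ) ≠ 0 := by exact_mod_cast n.factorial_ne_zero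
  field_simp

lemma id_pow (m : ℕ) : taylorSeries (fun t => t ^ m) = PowerSeries.X ^ m := by
  ext n
  rw [coeff, iteratedDeriv_fun_pow_zero, PowerSeries.coeff_X_pow]
  split_ifs with h
  · subst h
    exact div_self (by exact_mod_cast n.factorial_ne_zero)
  · simp

lemma const (c : ℂ) : taylorSeries (fun _ => c) = algebraMap ℂ (PowerSeries ℂ) c := by
  have h := smul c (fun t => t ^ 0)
  rw [id_pow, pow_zero, ← Algebra.algebraMap_eq_smul_one] at h
  rw [← h]
  congr 1
  ext t
  simp

lemma order {f : ℂ → ℂ} (hf : AnalyticAt ℂ f 0) :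
    (taylorSeries f).order = analyticOrderAt f 0 := by
  refine ENat.eq_of_forall_natCast_le_iff fun n => ?_
  rw [natCast_le_analyticOrderAt_iff_iteratedDeriv_eq_zero hf]
  have hc : ∀ i, PowerSeries.coeff i (taylorSeries f) = 0 ↔ iteratedDeriv i f 0 = 0 := fun i => by
    rw [coeff, div_eq_zero_iff, or_iff_left (by exact_mod_cast i.factorial_ne_zero)]
  simp only [← hc]
  exact ⟨fun h i hi => PowerSeries.coeff_of_lt_order i ((Nat.cast_lt.2 hi).trans_le h),
    PowerSeries.nat_le_order _ n⟩

lemma sub {f g : ℂ → ℂ} (hf : AnalyticAt ℂ f 0) (hg : AnalyticAt ℂ g 0) :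
    taylorSeries (f - g) = taylorSeries f - taylorSeries g := by
  have h := add (hf.sub hg) hg
  rw [sub_add_cancel] at h
  rw [h, add_sub_cancel_right]

lemma comp_neg (f : ℂ → ℂ) :
    taylorSeries (fun t => f (-t)) = PowerSeries.rescale (-1) (taylorSeries f) := by
  ext n
  rw [PowerSeries.coeff_rescale, coeff, coeff, iteratedDeriv_comp_neg, neg_zero, smul_eq_mul,
    mul_div_assoc]

lemma eventuallyEq {f g : ℂ → ℂ} (hf : AnalyticAt ℂ f 0) (hg : AnalyticAt ℂ g 0)
    (h : taylorSeries f = taylorSeries g) : f =ᶠ[𝓝 0] g := by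
  have h1 : analyticOrderAt (f - g) 0 = ⊤ := by
    rw [← order (hf.sub hg), sub hf hg, h, sub_self, PowerSeries.order_zero]
  filter_upwards [analyticOrderAt_eq_top.1 h1] with t ht using sub_eq_zero.1 ht

end taylorSeries

/-- If `f = t^k g` with `g(0) ≠ 0` and `k < N`, dividing the bound by `|t|^k` would force `g(0) =
0`. -/
lemma le_analyticOrderAt_of_isBigO {f : ℂ → ℂ} (hf : AnalyticAt ℂ f 0) {N : ℕ}
    (h : f =O[𝓝 0] fun t => ‖t‖ ^ N) : (N : ℕ∞) ≤ analyticOrderAt f 0 := by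
  by_contra! hlt
  obtain ⟨k, hk⟩ := ENat.ne_top_iff_exists.1 hlt.ne_top
  rw [← hk] at hlt
  have hkN : k < N := by exact_mod_cast hlt
  obtain ⟨g, hg, hg0, hfg⟩ := hf.analyticOrderAt_eq_natCast.1 hk.symm
  obtain ⟨c, hc⟩ := h.bound
  have hle : ∀ᶠ t in 𝓝[≠] (0 : ℂ), ‖g t‖ ≤ c * ‖t‖ ^ (N - k) := by
    filter_upwards [self_mem_nhdsWithin, hfg.filter_mono nhdsWithin_le_nhds,
      hc.filter_mono nhdsWithin_le_nhds] with t ht h1 h2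
    have ht : 0 < ‖t‖ := norm_pos_iff.2 ht
    rw [h1, sub_zero, norm_smul, norm_pow, norm_pow, norm_norm,
      ← Nat.add_sub_of_le hkN.le, pow_add, ← mul_assoc, mul_comm c, mul_assoc] at h2
    exact le_of_mul_le_mul_left (by simpa using h2) (pow_pos ht k)
  have h1 : Tendsto (fun t => ‖g t‖) (𝓝[≠] 0) (𝓝 ‖g 0‖) :=
    (hg.continuousAt.norm.tendsto).mono_left nhdsWithin_le_nhds
  have h2 : Tendsto (fun t : ℂ => c * ‖t‖ ^ (N - k)) (𝓝[≠] 0) (𝓝 0) := by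
    have : ContinuousAt (fun t : ℂ => c * ‖t‖ ^ (N - k)) 0 := by fun_prop
    have := this.tendsto
    rw [norm_zero, zero_pow (by omega), mul_zero] at this
    exact this.mono_left nhdsWithin_le_nhds
  exact hg0 (norm_le_zero_iff.1 (le_of_tendsto_of_tendsto h1 h2 hle))

/-! ### The values of holomorphic germs along a parametrized curve -/

/-- The orders of vanishing of `F ∘ n` for holomorphic germs `F` in two variables. -/
def valueSet (n : ℂ → ℂ × ℂ) : Set ℕ :=
  {v | ∃ F : ℂ × ℂ → ℂ, AnalyticAt ℂ F 0 ∧ analyticOrderAt (F ∘ n) 0 = v}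

/-- The algebra of the Taylor series of polynomials in the coordinates of a curve. -/
def coordinateAlgebra (n : ℂ → ℂ × ℂ) : Subalgebra ℂ (PowerSeries ℂ) :=
  Algebra.adjoin ℂ {taylorSeries fun t => (n t).1, taylorSeries fun t => (n t).2}

section Curve

variable {n : ℂ → ℂ × ℂ} (hn : AnalyticAt ℂ n 0) (h0 : n 0 = 0)
include hn h0

lemma analyticAt_comp_curve {F : ℂ × ℂ → ℂ} (hF : AnalyticAt ℂ F 0) : AnalyticAt ℂ (F ∘ n) 0 :=
  AnalyticAt.comp (by rwa [h0]) hn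

lemma exists_of_mem_coordinateAlgebra {p : PowerSeries ℂ} (hp : p ∈ coordinateAlgebra n) :
    ∃ F : ℂ × ℂ → ℂ, AnalyticAt ℂ F 0 ∧ taylorSeries (F ∘ n) = p := by
  induction hp using Algebra.adjoin_induction with
  | mem p hp =>
    rcases hp with rfl | rfl
    · exact ⟨Prod.fst, analyticAt_fst, rfl⟩
    · exact ⟨Prod.snd, analyticAt_snd, rfl⟩
  | algebraMap c => exact ⟨fun _ => c, analyticAt_const, taylorSeries.const c⟩
  | add p q _ _ hp hq =>
    obtain ⟨F, hF, rfl⟩ := hp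
    obtain ⟨G, hG, rfl⟩ := hq
    exact ⟨F + G, hF.add hG, taylorSeries.add (analyticAt_comp_curve hn h0 hF) (analyticAt_comp_curve hn h0 hG)⟩
  | mul p q _ _ hp hq =>
    obtain ⟨F, hF, rfl⟩ := hp
    obtain ⟨G, hG, rfl⟩ := hq
    exact ⟨F * G, hF.mul hG, taylorSeries.mul (analyticAt_comp_curve hn h0 hF) (analyticAt_comp_curve hn h0 hG)⟩

omit h0 in
lemma monomial_mem_coordinateAlgebra {k : ℕ} (s : Finset (Fin k)) (c : ℂ) :
    AnalyticAt ℂ (fun t => c * ∏ i, if i ∈ s then (n t).1 else (n t).2) 0 ∧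
    taylorSeries (fun t => c * ∏ i, if i ∈ s then (n t).1 else (n t).2) ∈ coordinateAlgebra n := by
  have hfst : AnalyticAt ℂ (fun t => (n t).1) 0 := analyticAt_fst.comp hn
  have hsnd : AnalyticAt ℂ (fun t => (n t).2) 0 := analyticAt_snd.comp hn
  have hprod : ∀ u : Finset (Fin k),
      AnalyticAt ℂ (fun t => ∏ i ∈ u, if i ∈ s then (n t).1 else (n t).2) 0 ∧
      taylorSeries (fun t => ∏ i ∈ u, if i ∈ s then (n t).1 else (n t).2) ∈
        coordinateAlgebra n := by
    intro u
    induction u using Finset.induction_on with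
    | empty =>
      simp only [Finset.prod_empty]
      exact ⟨analyticAt_const, by rw [taylorSeries.const]; exact Subalgebra.algebraMap_mem _ _⟩
    | insert i u hi ih =>
      simp only [Finset.prod_insert hi]
      have h1 : AnalyticAt ℂ (fun t => if i ∈ s then (n t).1 else (n t).2) 0 ∧
          taylorSeries (fun t => if i ∈ s then (n t).1 else (n t).2) ∈ coordinateAlgebra n := by
        split_ifs
        · exact ⟨hfst, Algebra.subset_adjoin (by simp)⟩
        · exact ⟨hsnd, Algebra.subset_adjoin (by simp)⟩
      exact ⟨h1.1.mul ih.1, (taylorSeries.mul h1.1 ih.1) ▸ mul_mem h1.2 ih.2⟩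
  refine ⟨analyticAt_const.mul (hprod _).1, ?_⟩
  have := taylorSeries.smul c (fun t => ∏ i, if i ∈ s then (n t).1 else (n t).2)
  exact this ▸ Subalgebra.smul_mem _ (hprod _).2 c

omit h0 in
-- Expanding each multilinear term along the two basis vectors gives a polynomial in the coordinates
-- of `n t`.
lemma partialSum_mem_coordinateAlgebra (p : FormalMultilinearSeries ℂ (ℂ × ℂ) ℂ) (N : ℕ) :
    AnalyticAt ℂ (fun t => p.partialSum N (n t)) 0 ∧
      taylorSeries (fun t => p.partialSum N (n t)) ∈ coordinateAlgebra n := by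
  have hsum : ∀ {ι : Type} (s : Finset ι) (f : ι → ℂ → ℂ),
      (∀ i ∈ s, AnalyticAt ℂ (f i) 0 ∧ taylorSeries (f i) ∈ coordinateAlgebra n) →
      AnalyticAt ℂ (∑ i ∈ s, f i) 0 ∧ taylorSeries (∑ i ∈ s, f i) ∈ coordinateAlgebra n := by
    intro ι s f hf
    refine Finset.sum_induction f
      (fun g => AnalyticAt ℂ g 0 ∧ taylorSeries g ∈ coordinateAlgebra n) ?_ ?_ hf
    · exact fun f g hf hg => ⟨hf.1.add hg.1, taylorSeries.add hf.1 hg.1 ▸ add_mem hf.2 hg.2⟩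
    · exact ⟨analyticAt_const, (taylorSeries.const 0) ▸ Subalgebra.algebraMap_mem _ _⟩
  have hk : ∀ k, AnalyticAt ℂ (fun t => p k fun _ => n t) 0 ∧
      taylorSeries (fun t => p k fun _ => n t) ∈ coordinateAlgebra n := by
    intro k
    have : (fun t => p k fun _ => n t) = ∑ s : Finset (Fin k), fun t =>
        (p k fun i => if i ∈ s then ((1, 0) : ℂ × ℂ) else (0, 1)) *
          ∏ i, if i ∈ s then (n t).1 else (n t).2 := by
      ext t
      have h1 : (fun _ : Fin k => n t) = (fun _ => (n t).1 • ((1, 0) : ℂ × ℂ)) +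
          fun _ => (n t).2 • ((0, 1) : ℂ × ℂ) := by
        ext <;> simp
      rw [h1, ContinuousMultilinearMap.map_add_univ, Finset.sum_apply]
      refine Finset.sum_congr rfl fun s _ => ?_
      rw [mul_comm, ← smul_eq_mul, ← ContinuousMultilinearMap.map_smul_univ]
      congr 1
      ext i : 1
      by_cases hi : i ∈ s <;> simp [Finset.piecewise, hi]
    rw [this]
    exact hsum _ _ fun s _ => monomial_mem_coordinateAlgebra hn s _
  have : (fun t => p.partialSum N (n t)) = ∑ k ∈ Finset.range N, fun t => p k fun _ => n t := by
    ext t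
    simp [FormalMultilinearSeries.partialSum]
  rw [this]
  exact hsum _ _ fun k _ => hk k

lemma curve_isBigO : n =O[𝓝 0] fun t : ℂ => t := by
  have := hn.differentiableAt.hasFDerivAt.isBigO_sub
  simpa [h0] using this

/-- Truncating `F` at degree `N` leaves an error `O(|n(t)|^N) = O(|t|^N)`. -/
lemma exists_approx {F : ℂ × ℂ → ℂ} (hF : AnalyticAt ℂ F 0) (N : ℕ) :
    ∃ p ∈ coordinateAlgebra n, (N : ℕ∞) ≤ (taylorSeries (F ∘ n) - p).order := by
  obtain ⟨p, hp⟩ := hF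
  obtain ⟨h1, h2⟩ := partialSum_mem_coordinateAlgebra hn p N
  have hFn := analyticAt_comp_curve hn h0 hp.analyticAt
  refine ⟨_, h2, ?_⟩
  rw [← taylorSeries.sub hFn h1, taylorSeries.order (hFn.sub h1)]
  refine le_analyticOrderAt_of_isBigO (hFn.sub h1) ?_
  have h3 := hp.isBigO_sub_partialSum_pow N
  have h4 : Tendsto n (𝓝 0) (𝓝 0) := by simpa [h0] using hn.continuousAt.tendsto
  have h5 := (h3.comp_tendsto h4).trans (((curve_isBigO hn h0).norm_norm).pow N)
  have h6 : (fun t => F (n t) - p.partialSum N (n t)) =O[𝓝 0] fun t => ‖t‖ ^ N := by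
    simpa [Function.comp_def] using h5
  exact h6

lemma mem_valueSet_iff {v : ℕ} : v ∈ valueSet n ↔ ∃ p ∈ coordinateAlgebra n, p.order = v := by
  constructor
  · rintro ⟨F, hF, hv⟩
    rw [← taylorSeries.order (analyticAt_comp_curve hn h0 hF)] at hv
    obtain ⟨p, hp, hle⟩ := exists_approx hn h0 hF (v + 1)
    refine ⟨p, hp, ?_⟩
    rw [show p = taylorSeries (F ∘ n) + -(taylorSeries (F ∘ n) - p) by ring,
      PowerSeries.order_add_of_lt, hv]
    rw [PowerSeries.order_neg, hv]
    exact lt_of_lt_of_le (by exact_mod_cast v.lt_succ_self) hle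
  · rintro ⟨p, hp, hv⟩
    obtain ⟨F, hF, rfl⟩ := exists_of_mem_coordinateAlgebra hn h0 hp
    exact ⟨F, hF, by rw [← taylorSeries.order (analyticAt_comp_curve hn h0 hF), hv]⟩

end Curve

lemma valueSet_swap (n : ℂ → ℂ × ℂ) : valueSet (Prod.swap ∘ n) = valueSet n := by
  have key : ∀ n : ℂ → ℂ × ℂ, valueSet (Prod.swap ∘ n) ⊆ valueSet n := by
    rintro n v ⟨F, hF, hv⟩
    refine ⟨F ∘ Prod.swap, AnalyticAt.comp (by simpa using hF) ?_, hv⟩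
    exact analyticAt_snd.prod analyticAt_fst
  exact (key n).antisymm (by simpa [← Function.comp_assoc] using key (Prod.swap ∘ n))

lemma valueSet_comp (n : ℂ → ℂ × ℂ) {σ : ℂ → ℂ} (hσ : AnalyticAt ℂ σ 0) (hσ0 : σ 0 = 0)
    (hσ' : deriv σ 0 ≠ 0) : valueSet (n ∘ σ) = valueSet n := by
  ext v
  refine exists_congr fun F => and_congr_right fun _ => ?_
  rw [← Function.comp_assoc, analyticOrderAt_comp_of_deriv_ne_zero hσ hσ', hσ0]

/-! ### Normal form of a parametrized curve -/

lemma valueSet_congr {n n' : ℂ → ℂ × ℂ} (h : n =ᶠ[𝓝 0] n') : valueSet n = valueSet n' := by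
  ext v
  refine exists_congr fun F => and_congr_right fun _ => ?_
  rw [analyticOrderAt_congr (h.fun_comp F)]

/-- A function with a zero of order `m` becomes `t ↦ t ^ m` after a change of the parameter. -/
lemma exists_reparametrization {x : ℂ → ℂ} (hx : AnalyticAt ℂ x 0) {m : ℕ} (hm : m ≠ 0)
    (hord : analyticOrderAt x 0 = m) :
    ∃ σ τ : ℂ → ℂ, AnalyticAt ℂ σ 0 ∧ σ 0 = 0 ∧ deriv σ 0 ≠ 0 ∧
      (∀ᶠ t in 𝓝 0, x (σ t) = t ^ m) ∧ ∀ᶠ t in 𝓝 0, τ (σ t) = t := by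
  obtain ⟨g, hg, hg0, hxg⟩ := hx.analyticOrderAt_eq_natCast.1 hord
  obtain ⟨c, hc⟩ := IsAlgClosed.exists_pow_nat_eq (g 0) (Nat.pos_of_ne_zero hm)
  have hc0 : c ≠ 0 := by
    rintro rfl
    exact hg0 (by rw [← hc, zero_pow hm])
  -- An analytic `m`-th root of `g`: normalizing by `g 0` keeps the principal power near 1, off the
  -- branch cut. Then `τ = t u` satisfies `τ^m = x`, and `σ` is its local inverse.
  set u : ℂ → ℂ := fun t => c * (g t / g 0) ^ ((m : ℂ)⁻¹) with hu
  have hua : AnalyticAt ℂ u 0 := by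
    refine analyticAt_const.mul ((hg.div analyticAt_const hg0).cpow analyticAt_const ?_)
    simp [div_self hg0]
  have hu0 : u 0 = c := by simp [hu, div_self hg0]
  have hum : ∀ t, u t ^ m = g t := fun t => by
    rw [hu]
    simp only
    rw [mul_pow, Complex.cpow_nat_inv_pow _ hm, hc, mul_div_cancel₀ _ hg0]
  set τ : ℂ → ℂ := fun t => t * u t with hτ
  have hτa : AnalyticAt ℂ τ 0 := analyticAt_id.mul hua
  have hτd : deriv τ 0 = c := by
    have := (hasDerivAt_id (0 : ℂ)).mul hua.differentiableAt.hasDerivAt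
    rw [id, one_mul, zero_mul, add_zero, hu0] at this
    exact this.deriv
  have hτ' : deriv τ 0 ≠ 0 := hτd ▸ hc0
  have hτ0 : τ 0 = 0 := by simp [hτ]
  set σ := hτa.hasStrictDerivAt.localInverse _ _ _ hτ' with hσ
  have hσa : AnalyticAt ℂ σ 0 := by simpa [hτ0] using hτa.analyticAt_localInverse hτ'
  have hσ0 : σ 0 = 0 := by
    have : σ (τ 0) = 0 := HasStrictFDerivAt.localInverse_apply_image ..
    rwa [hτ0] at this
  have hτσ : ∀ᶠ t in 𝓝 0, τ (σ t) = t := by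
    have := HasStrictDerivAt.eventually_right_inverse hτa.hasStrictDerivAt hτ'
    rwa [hτ0] at this
  have hσd : deriv σ 0 = (deriv τ 0)⁻¹ := by
    have := (hτa.hasStrictDerivAt.to_localInverse hτ').hasDerivAt.deriv
    rwa [hτ0] at this
  refine ⟨σ, τ, hσa, hσ0, hσd ▸ inv_ne_zero hτ', ?_, hτσ⟩
  have hσt : Tendsto σ (𝓝 0) (𝓝 0) := by simpa [hσ0] using hσa.continuousAt.tendsto
  filter_upwards [hτσ, hσt.eventually hxg] with t h1 h2
  rw [h2, sub_zero, smul_eq_mul, ← hum, ← mul_pow]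
  exact congrArg (· ^ m) h1

lemma PowerSeries.rescale_X_pow {K : Type*} [Field K] {w : K} {m : ℕ} (hw : w ^ m = 1) :
    PowerSeries.rescale w ((PowerSeries.X : PowerSeries K) ^ m) = PowerSeries.X ^ m := by
  rw [map_pow, PowerSeries.rescale_X, mul_pow, ← map_pow, hw, map_one, one_mul]

/-! ### Orders from `ℂ[t^m, y]` versus orders from polynomials over invariant series. -/

section Adjoin

variable {w : ℂ} {m : ℕ} {y : PowerSeries ℂ}

lemma exists_invariant_polynomial (hw : IsPrimitiveRoot w m) {p : PowerSeries ℂ}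
    (hp : p ∈ Algebra.adjoin ℂ {PowerSeries.X ^ m, y}) :
    ∃ h : (PowerSeries ℂ)[X], h.map (PowerSeries.rescale w) = h ∧ h.eval y = p := by
  induction hp using Algebra.adjoin_induction with
  | mem p hp =>
    rcases hp with rfl | rfl
    · exact ⟨C (PowerSeries.X ^ m), by
        rw [Polynomial.map_C, PowerSeries.rescale_X_pow hw.pow_eq_one], eval_C⟩
    · exact ⟨X, Polynomial.map_X _, eval_X⟩
  | algebraMap c =>
    refine ⟨C (PowerSeries.C c), ?_, eval_C⟩
    rw [Polynomial.map_C]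
    congr 1
    ext j
    rw [PowerSeries.coeff_rescale, PowerSeries.coeff_C]
    split_ifs with hj <;> simp [hj]
  | add p q _ _ hp hq =>
    obtain ⟨h, hh, rfl⟩ := hp
    obtain ⟨h', hh', rfl⟩ := hq
    exact ⟨h + h', by rw [Polynomial.map_add, hh, hh'], eval_add⟩
  | mul p q _ _ hp hq =>
    obtain ⟨h, hh, rfl⟩ := hp
    obtain ⟨h', hh', rfl⟩ := hq
    exact ⟨h * h', by rw [Polynomial.map_mul, hh, hh'], eval_mul⟩

/-- An invariant series involves only powers of `t^m`, so its truncations are polynomials in `t^m`.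
-/
lemma exists_adjoin_approx_of_invariant (hw : IsPrimitiveRoot w m) {c : PowerSeries ℂ}
    (hc : PowerSeries.rescale w c = c) (N : ℕ) :
    ∃ p ∈ Algebra.adjoin ℂ {PowerSeries.X ^ m, y}, (N : ℕ∞) ≤ (c - p).order := by
  rw [PowerSeries.rescale_eq_self_iff hw] at hc
  refine ⟨∑ i ∈ Finset.range N, PowerSeries.coeff i c • PowerSeries.X ^ i,
    sum_mem fun i _ => ?_, PowerSeries.nat_le_order _ _ fun j hj => ?_⟩
  · by_cases hi : PowerSeries.coeff i c = 0
    · rw [hi, zero_smul]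
      exact zero_mem _
    · obtain ⟨r, rfl⟩ := hc i hi
      refine Subalgebra.smul_mem _ ?_ _
      rw [pow_mul]
      exact pow_mem (Algebra.subset_adjoin (by simp)) r
  · rw [map_sub, map_sum, Finset.sum_eq_single_of_mem j (Finset.mem_range.2 hj)]
    · simp
    · intro i _ hij
      rw [PowerSeries.coeff_smul, PowerSeries.coeff_X_pow, if_neg hij.symm, smul_zero]

lemma exists_adjoin_approx (hw : IsPrimitiveRoot w m) {h : (PowerSeries ℂ)[X]}
    (hh : h.map (PowerSeries.rescale w) = h) (N : ℕ) :
    ∃ p ∈ Algebra.adjoin ℂ {PowerSeries.X ^ m, y}, (N : ℕ∞) ≤ (h.eval y - p).order := by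
  have hc : ∀ i, PowerSeries.rescale w (h.coeff i) = h.coeff i := fun i => by
    conv_rhs => rw [← hh, coeff_map]
  choose p hp hpN using fun i => exists_adjoin_approx_of_invariant (y := y) hw (hc i) N
  refine ⟨∑ i ∈ Finset.range (h.natDegree + 1), p i * y ^ i,
    sum_mem fun i _ => mul_mem (hp i) (pow_mem (Algebra.subset_adjoin (by simp)) i), ?_⟩
  rw [eval_eq_sum_range, ← Finset.sum_sub_distrib]
  refine Finset.sum_induction _ (fun g : PowerSeries ℂ => (N : ℕ∞) ≤ g.order) (fun g g' hg hg' => ?_) ?_ ?_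
  · exact (le_min hg hg').trans (PowerSeries.min_order_le_order_add g g')
  · rw [PowerSeries.order_zero]; exact le_top
  · intro i _
    rw [← sub_mul, PowerSeries.order_mul]
    exact (hpN i).trans le_self_add

lemma mem_orders_iff (hw : IsPrimitiveRoot w m) {v : ℕ} :
    v ∈ RescaleOrbit.orders w y ↔
      ∃ p ∈ Algebra.adjoin ℂ {PowerSeries.X ^ m, y}, p.order = v := by
  constructor
  · rintro ⟨h, hh, hv⟩
    obtain ⟨p, hp, hle⟩ := exists_adjoin_approx (y := y) hw hh (v + 1)
    refine ⟨p, hp, ?_⟩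
    rw [show p = h.eval y + -(h.eval y - p) by ring, PowerSeries.order_add_of_lt, hv]
    rw [PowerSeries.order_neg, hv]
    exact lt_of_lt_of_le (by exact_mod_cast v.lt_succ_self) hle
  · rintro ⟨p, hp, hv⟩
    obtain ⟨h, hh, rfl⟩ := exists_invariant_polynomial hw hp
    exact ⟨h, hh, hv⟩

end Adjoin

/-! ### The first odd exponent -/

open RescaleOrbit in
/-- Orders for a Puiseux series `y` in `t = x ^ (1 / m)`, `m` even, having an odd exponent. -/
theorem exists_orders_of_odd_exponent {K : Type*} [Field K] {w : K} {m : ℕ}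
    (hw : IsPrimitiveRoot w m) (hm : 0 < m) (hm2 : Even m) {y : PowerSeries K}
    (hy : ∃ k, Odd k ∧ PowerSeries.coeff k y ≠ 0) :
    ∃ q b k, 2 ∣ q ∧ Odd k ∧ q ∣ b ∧ b + k ∈ orders w y ∧
      (∀ v ∈ orders w y, v < b + k → q ∣ v) ∧ ∀ v, b ≤ v → q ∣ v → v ∈ orders w y := by
  classical
  set k := Nat.find hy with hk
  obtain ⟨hkodd, hk0⟩ := Nat.find_spec hy
  have hmin : ∀ j < k, PowerSeries.coeff j y ≠ 0 → 2 ∣ j := fun j hj hj0 => by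
    have := Nat.find_min hy hj
    rw [not_and_not_right] at this
    exact even_iff_two_dvd.1 (Nat.not_odd_iff_even.1 fun h => hj0 (by simpa using this h))
  set supp := (Finset.range k).filter fun j => PowerSeries.coeff j y ≠ 0 with hsupp
  set q := Nat.gcd m (supp.gcd id) with hq
  set z₀ : PowerSeries K := ((PowerSeries.trunc k y : K[X]) : PowerSeries K) with hz₀
  have hz : ∀ j, PowerSeries.coeff j z₀ = if j < k then PowerSeries.coeff j y else 0 := fun j => by
    rw [hz₀, Polynomial.coeff_coe, PowerSeries.coeff_trunc]
  -- All conjugates of `z₀` have exponents below `k`, so distinct ones already differ there.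
  have A : Approx w m z₀ y k := by
    refine ⟨hw, hm, PowerSeries.order_eq_nat.2 ⟨?_, fun i hi => ?_⟩, ?_⟩
    · simpa [hz] using hk0
    · simp [hz, hi]
    · intro z hz' hne
      obtain ⟨i, -, rfl⟩ := mem_orbit.1 hz'
      obtain ⟨j, hj⟩ := PowerSeries.exists_coeff_ne_zero_iff_ne_zero.2 (sub_ne_zero.2 hne.symm)
      refine (PowerSeries.order_le j hj).trans_lt (Nat.cast_lt.2 ?_)
      by_contra! hjk
      simp [PowerSeries.coeff_rescale, hz, hjk.not_gt] at hj
  have hqm : q ∣ m := Nat.gcd_dvd_left _ _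
  have hu : IsPrimitiveRoot (w ^ (m / q)) q := hw.pow hm (Nat.div_mul_cancel hqm).symm
  have hfix : PowerSeries.rescale (w ^ (m / q)) z₀ = z₀ := by
    refine (PowerSeries.rescale_eq_self_iff hu _).2 fun j hj => ?_
    rw [hz] at hj
    have hjk : j < k := by by_contra h; simp [h] at hj
    rw [if_pos hjk] at hj
    exact (Nat.gcd_dvd_right _ _).trans
      (Finset.gcd_dvd (f := id) (Finset.mem_filter.2 ⟨Finset.mem_range.2 hjk, hj⟩))
  obtain ⟨b, hb⟩ := A.exists_orders hu rfl hfix fun i j hij => by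
    have hw0 : w ≠ 0 := hw.ne_zero hm.ne'
    -- The root of unity `r` fixes `t^m` and every monomial of `z₀`, so its order divides `q`.
    set r := w ^ i / w ^ j with hr
    have hrl : ∀ l, w ^ (i * l) = w ^ (j * l) ↔ r ^ l = 1 := fun l => by
      rw [hr, div_pow, ← pow_mul, ← pow_mul, div_eq_one_iff_eq (pow_ne_zero _ hw0)]
    rw [hrl, ← orderOf_dvd_iff_pow_eq_one]
    refine Nat.dvd_gcd ?_ (Finset.dvd_gcd fun l hl => ?_)
    · rw [orderOf_dvd_iff_pow_eq_one, ← hrl, mul_comm i, mul_comm j, pow_mul, pow_mul,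
        hw.pow_eq_one, one_pow, one_pow]
    · obtain ⟨hlk, hl0⟩ := Finset.mem_filter.1 hl
      rw [Finset.mem_range] at hlk
      have := congrArg (PowerSeries.coeff l) hij
      rw [PowerSeries.coeff_rescale, PowerSeries.coeff_rescale, hz, if_pos hlk] at this
      rw [id, orderOf_dvd_iff_pow_eq_one, ← hrl, pow_mul, pow_mul]
      exact mul_right_cancel₀ hl0 this
  refine ⟨q, b, k, ?_, hkodd, hb⟩
  refine Nat.dvd_gcd (even_iff_two_dvd.1 hm2) (Finset.dvd_gcd fun l hl => ?_)
  obtain ⟨hlk, hl0⟩ := Finset.mem_filter.1 hl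
  exact hmin l (Finset.mem_range.1 hlk) hl0

/-- The values along an injectively parametrized curve whose first coordinate has even order. -/
theorem exists_valueSet_of_even_order {n : ℂ → ℂ × ℂ} (hn : AnalyticAt ℂ n 0) (h0 : n 0 = 0)
    (hinj : ∃ V ∈ 𝓝 (0 : ℂ), Set.InjOn n V) {m : ℕ} (hm : 0 < m) (hm2 : Even m)
    (hord : analyticOrderAt (fun t => (n t).1) 0 = m) :
    ∃ q b k, 2 ∣ q ∧ Odd k ∧ q ∣ b ∧ b + k ∈ valueSet n ∧
      (∀ v ∈ valueSet n, v < b + k → q ∣ v) ∧ ∀ v, b ≤ v → q ∣ v → v ∈ valueSet n := by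
  obtain ⟨σ, τ, hσ, hσ0, hσ', hx, hτ⟩ :=
    exists_reparametrization (analyticAt_fst.comp hn) hm.ne' hord
  set Y : ℂ → ℂ := fun t => (n (σ t)).2 with hY
  have hσt : Tendsto σ (𝓝 0) (𝓝 0) := by simpa [hσ0] using hσ.continuousAt.tendsto
  have hYa : AnalyticAt ℂ Y 0 := by
    refine analyticAt_snd.comp (AnalyticAt.comp (g := n) (f := σ) ?_ hσ)
    rwa [hσ0]
  set n' : ℂ → ℂ × ℂ := fun t => (t ^ m, Y t) with hn'
  have hn'a : AnalyticAt ℂ n' 0 := (analyticAt_id.pow m).prod hYa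
  have hn'0 : n' 0 = 0 := by simp [hn', hY, hσ0, h0, hm.ne']
  have heq : n ∘ σ =ᶠ[𝓝 0] n' := by
    filter_upwards [hx] with t ht
    exact Prod.ext ht rfl
  have hval : valueSet n = valueSet n' := by
    rw [← valueSet_comp n hσ hσ0 hσ', valueSet_congr heq]
  obtain ⟨w, hw⟩ : ∃ w : ℂ, IsPrimitiveRoot w m := ⟨_, Complex.isPrimitiveRoot_exp m hm.ne'⟩
  have horders : valueSet n = RescaleOrbit.orders w (taylorSeries Y) := by
    ext v
    rw [hval, mem_valueSet_iff hn'a hn'0, mem_orders_iff hw, coordinateAlgebra,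
      taylorSeries.id_pow]
  rw [horders]
  refine exists_orders_of_odd_exponent hw hm hm2 ?_
  -- Without odd exponents `Y` is even, and so is `t^m`; then `t` and `-t` have the same image,
  -- against injectivity.
  by_contra! hodd
  have hYeven : (fun t => Y (-t)) =ᶠ[𝓝 0] Y := by
    have hneg : AnalyticAt ℂ (fun t : ℂ => -t) 0 := analyticAt_id.neg
    refine taylorSeries.eventuallyEq (AnalyticAt.comp (g := Y) (by simpa using hYa) hneg) hYa ?_
    rw [taylorSeries.comp_neg, PowerSeries.rescale_eq_self_iff (IsPrimitiveRoot.neg_one 0 (by simp))]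
    intro j hj
    exact even_iff_two_dvd.1 (Nat.not_odd_iff_even.1 fun h => hj (hodd j h))
  obtain ⟨V, hV, hVinj⟩ := hinj
  have hneg : Tendsto (fun t : ℂ => -t) (𝓝 0) (𝓝 0) := by
    simpa using (continuous_neg (G := ℂ)).tendsto 0
  have hev : ∀ᶠ t in 𝓝 (0 : ℂ), t = 0 := by
    filter_upwards [hYeven, heq, hneg.eventually heq, hτ, hneg.eventually hτ, hσt hV,
      (hσt.comp hneg) hV] with t h1 h2 h3 h4 h5 h6 h7
    have h8 : n (σ (-t)) = n (σ t) := by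
      refine h3.trans (Eq.trans ?_ h2.symm)
      exact Prod.ext (hm2.neg_pow t) h1
    have h9 : σ (-t) = σ t := hVinj h7 h6 h8
    rw [h9, h4] at h5
    exact self_eq_neg.1 h5
  have : (𝓝[≠] (0 : ℂ)).NeBot := inferInstance
  obtain ⟨t, ht, ht0⟩ :=
    ((hev.filter_mono nhdsWithin_le_nhds).and (self_mem_nhdsWithin (s := {(0 : ℂ)}ᶜ))).exists
  exact ht0 ht

/-! ### Minimal generators of semigroups -/

namespace IsMinimalGenerators

variable {S : Set ℕ} {g : ℕ} {β : Fin (g + 1) → ℕ} (hβ : IsMinimalGenerators S β)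
include hβ

lemma mem (i : Fin (g + 1)) : β i ∈ S :=
  hβ.closure_eq ▸ AddSubmonoid.subset_closure (Set.mem_range_self i)

lemma pos (i : Fin (g + 1)) : 0 < β i := by
  by_contra h
  have h0 : β i = 0 := by omega
  exact hβ.minimal i (h0 ▸ zero_mem _)

lemma mem_of_generators (P : AddSubmonoid ℕ) (h : ∀ i, β i ∈ P) {v : ℕ} (hv : v ∈ S) : v ∈ P := by
  rw [← hβ.closure_eq] at hv
  refine (AddSubmonoid.closure_le (S := P)).2 ?_ hv
  rintro _ ⟨i, rfl⟩
  exact h i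

lemma le_of_pos {v : ℕ} (hv : v ∈ S) (h : 0 < v) : β 0 ≤ v := by
  have := hβ.mem_of_generators
    { carrier := {v | v = 0 ∨ β 0 ≤ v}
      zero_mem' := Or.inl rfl
      add_mem' := fun {a b} ha hb => by
        simp only [Set.mem_ofPred_eq] at *
        omega } (fun i => Or.inr (hβ.strictMono.monotone (Fin.zero_le i))) hv
  exact this.resolve_left h.ne'

/-- The multiples of `d` together with all numbers at least `β_g` form a submonoid containing every
generator. -/
lemma dvd_or_last_le {d : ℕ} (hd : ∀ i : Fin g, d ∣ β i.castSucc) {v : ℕ} (hv : v ∈ S) :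
    d ∣ v ∨ β (Fin.last g) ≤ v := by
  refine hβ.mem_of_generators
    { carrier := {v | d ∣ v ∨ β (Fin.last g) ≤ v}
      zero_mem' := Or.inl (dvd_zero d)
      add_mem' := fun {a b} ha hb => by
        rcases ha with ha | ha
        · rcases hb with hb | hb
          · exact Or.inl (dvd_add ha hb)
          · exact Or.inr (le_add_left hb)
        · exact Or.inr (le_add_right ha) } (fun i => ?_) hv
  rcases Fin.eq_castSucc_or_eq_last i with ⟨j, rfl⟩ | rfl
  · exact Or.inl (hd j)
  · exact Or.inr le_rfl

end IsMinimalGenerators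

/-! ### The values along a curve with `gcd(β₀, …, β_{g-1}) = 2` -/

section Curve

variable {n : ℂ → ℂ × ℂ} (hn : AnalyticAt ℂ n 0) (h0 : n 0 = 0)
include hn h0

/-- Every positive value is at least the order of one of the coordinates. -/
lemma order_coordinate_le {v : ℕ} (hv : v ∈ valueSet n) (hpos : 0 < v) :
    analyticOrderAt (fun t => (n t).1) 0 ≤ v ∨ analyticOrderAt (fun t => (n t).2) 0 ≤ v := by
  by_contra! h
  obtain ⟨hx, hy⟩ := h
  rw [← taylorSeries.order (f := fun t => (n t).1) (analyticAt_fst.comp hn)] at hx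
  rw [← taylorSeries.order (f := fun t => (n t).2) (analyticAt_snd.comp hn)] at hy
  obtain ⟨p, hp, hpv⟩ := (mem_valueSet_iff hn h0).1 hv
  -- If both coordinates had order above `v`, every element of the algebra would be a constant plus
  -- terms of order above `v`, with no `t^v` term.
  have key : ∃ c : ℂ, (v : ℕ∞) < (p - algebraMap ℂ (PowerSeries ℂ) c).order := by
    clear hpv
    have htop : (v : ℕ∞) ≠ ⊤ := ENat.natCast_ne_top v
    induction hp using Algebra.adjoin_induction with
    | mem p hp =>
      refine ⟨0, ?_⟩
      rw [map_zero, sub_zero]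
      rcases hp with rfl | rfl
      · exact hx
      · exact hy
    | algebraMap c => exact ⟨c, by rw [sub_self, PowerSeries.order_zero]; exact htop.lt_top⟩
    | add p q _ _ hp hq =>
      obtain ⟨c, hc⟩ := hp
      obtain ⟨d, hd⟩ := hq
      refine ⟨c + d, ?_⟩
      rw [map_add, add_sub_add_comm]
      exact (lt_min hc hd).trans_le (PowerSeries.min_order_le_order_add _ _)
    | mul p q _ _ hp hq =>
      obtain ⟨c, hc⟩ := hp
      obtain ⟨d, hd⟩ := hq
      refine ⟨c * d, ?_⟩
      rw [map_mul, show p * q - algebraMap ℂ (PowerSeries ℂ) c * algebraMap ℂ (PowerSeries ℂ) d =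
        (p - algebraMap ℂ (PowerSeries ℂ) c) * q +
          algebraMap ℂ (PowerSeries ℂ) c * (q - algebraMap ℂ (PowerSeries ℂ) d) by ring]
      refine lt_of_lt_of_le (lt_min ?_ ?_) (PowerSeries.min_order_le_order_add _ _)
      · rw [PowerSeries.order_mul]; exact hc.trans_le le_self_add
      · rw [PowerSeries.order_mul]; exact hd.trans_le le_add_self
  obtain ⟨c, hc⟩ := key
  have h1 := PowerSeries.coeff_of_lt_order v hc
  have h2 := (PowerSeries.order_eq_nat.1 hpv).1
  rw [map_sub, PowerSeries.algebraMap_apply, PowerSeries.coeff_C, if_neg hpos.ne', sub_zero] at h1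
  exact h2 h1

/-- The semigroup is even below some odd number, above which it contains all even numbers. -/
theorem exists_even_below_above (hinj : ∃ V ∈ 𝓝 (0 : ℂ), Set.InjOn n V) {g : ℕ}
    {β : Fin (g + 1) → ℕ} (hβ : IsMinimalGenerators (valueSet n) β)
    (hl : (Finset.univ.gcd fun i : Fin g => β i.castSucc) = 2) :
    ∃ p, (∀ v ∈ valueSet n, v < 2 * p + 1 → Even v) ∧
      ∀ v, 2 * p ≤ v → Even v → v ∈ valueSet n := by
  have hdvd : ∀ i : Fin g, 2 ∣ β i.castSucc := fun i => hl ▸ Finset.gcd_dvd (Finset.mem_univ i)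
  have hg : g ≠ 0 := by rintro rfl; simp at hl
  have h0even : Even (β 0) := even_iff_two_dvd.2 (hdvd ⟨0, Nat.pos_of_ne_zero hg⟩)
  -- Some coordinate has order exactly `β₀`; swapping the coordinates makes it the first.
  have hmain : ∃ q b k, 2 ∣ q ∧ Odd k ∧ q ∣ b ∧ b + k ∈ valueSet n ∧
      (∀ v ∈ valueSet n, v < b + k → q ∣ v) ∧ ∀ v, b ≤ v → q ∣ v → v ∈ valueSet n := by
    have hle : ∀ n' : ℂ → ℂ × ℂ, AnalyticAt ℂ n' 0 → n' 0 = 0 → valueSet n' = valueSet n →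
        analyticOrderAt (fun t => (n' t).1) 0 ≤ β 0 →
        analyticOrderAt (fun t => (n' t).1) 0 = β 0 := by
      intro n' hn' hn'0 hval hle
      obtain ⟨m, hm⟩ := ENat.ne_top_iff_exists.1 (ne_top_of_le_ne_top (ENat.natCast_ne_top _) hle)
      have hmem : m ∈ valueSet n := hval ▸ ⟨Prod.fst, analyticAt_fst, hm.symm⟩
      have hpos : 0 < m := by
        have : analyticOrderAt (fun t => (n' t).1) 0 ≠ 0 :=
          ((analyticAt_fst.comp hn').analyticOrderAt_ne_zero).2 (by simp [hn'0])
        rw [← hm] at this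
        exact Nat.pos_of_ne_zero (by exact_mod_cast this)
      exact le_antisymm hle (by rw [← hm]; exact_mod_cast hβ.le_of_pos hmem hpos)
    rcases order_coordinate_le hn h0 (hβ.mem 0) (hβ.pos 0) with h | h
    · exact exists_valueSet_of_even_order hn h0 hinj (hβ.pos 0) h0even (hle n hn h0 rfl h)
    · have hn' : AnalyticAt ℂ (Prod.swap ∘ n) 0 :=
        (analyticAt_snd.comp hn).prod (analyticAt_fst.comp hn)
      have hn'0 : (Prod.swap ∘ n) 0 = 0 := by simp [h0]
      have := exists_valueSet_of_even_order hn' hn'0 ?_ (hβ.pos 0) h0even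
        (hle _ hn' hn'0 (valueSet_swap n) h)
      · rwa [valueSet_swap] at this
      · obtain ⟨V, hV, hVn⟩ := hinj
        exact ⟨V, hV, Prod.swap_injective.comp_injOn hVn⟩
  obtain ⟨q, b, k, hq2, hk, hqb, hmem, hbelow, habove⟩ := hmain
  have hodd : ¬ 2 ∣ b + k := by
    have := hq2.trans hqb
    rw [Nat.dvd_add_right this]
    exact hk.not_two_dvd_nat
  -- The odd value `b + k` must involve `β_g`, the other generators being even.
  have hlast : β (Fin.last g) ≤ b + k := (hβ.dvd_or_last_le hdvd hmem).resolve_left hodd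
  have hq : q = 2 := by
    refine Nat.dvd_antisymm ?_ hq2
    rw [← hl]
    exact Finset.dvd_gcd fun i _ => hbelow _ (hβ.mem _)
      ((hβ.strictMono (Fin.castSucc_lt_last i)).trans_le hlast)
  subst hq
  obtain ⟨r, rfl⟩ := hk
  obtain ⟨c, rfl⟩ := hqb
  refine ⟨c + r, fun v hv hlt => even_iff_two_dvd.2 (hbelow v hv (by omega)), fun v hle hv =>
    habove v (by omega) (even_iff_two_dvd.1 hv)⟩

end Curve

/-! ### The Hilbert function of the valuation filtration -/

/-- `W'` is the kernel of the surjection `V → V/W × ℂ` given by the projection and `φ`. -/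
lemma finrank_quotient_eq_of_functional {V : Type*} [AddCommGroup V] [Module ℂ V]
    {W W' : Submodule ℂ V} (φ : V →ₗ[ℂ] ℂ) (hW : ∀ x, x ∈ W' ↔ x ∈ W ∧ φ x = 0)
    {x₀ : V} (hx₀ : x₀ ∈ W) (hφ : φ x₀ ≠ 0) [Module.Finite ℂ (V ⧸ W)] :
    Module.Finite ℂ (V ⧸ W') ∧ Module.finrank ℂ (V ⧸ W') = Module.finrank ℂ (V ⧸ W) + 1 := by
  have hker : LinearMap.ker (W.mkQ.prod φ) = W' := by
    ext x
    simp [hW]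
  have hsurj : Function.Surjective (W.mkQ.prod φ) := by
    rintro ⟨a, b⟩
    obtain ⟨v, rfl⟩ := W.mkQ_surjective a
    refine ⟨v + ((b - φ v) / φ x₀) • x₀, Prod.ext ?_ ?_⟩
    · have : W.mkQ x₀ = 0 := by simpa using hx₀
      change W.mkQ (v + ((b - φ v) / φ x₀) • x₀) = W.mkQ v
      rw [map_add, map_smul, this, smul_zero, add_zero]
    · change φ (v + ((b - φ v) / φ x₀) • x₀) = b
      rw [map_add, map_smul, smul_eq_mul, div_mul_cancel₀ _ hφ, add_sub_cancel]
  have E : (V ⧸ W') ≃ₗ[ℂ] (V ⧸ W) × ℂ :=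
    (Submodule.quotEquivOfEq _ _ hker.symm).trans
      ((W.mkQ.prod φ).quotKerEquivOfSurjective hsurj)
  exact ⟨Module.Finite.equiv E.symm, by rw [E.finrank_eq, Module.finrank_prod, Module.finrank_self]⟩

section DoubleQuotient

variable {B : Type*} [CommRing B] [Algebra ℂ B] {J : Ideal B}

lemma finite_quotient_of_eq_top {I : Ideal (B ⧸ J)} (hI : I = ⊤) :
    Module.Finite ℂ ((B ⧸ J) ⧸ I) := by
  have : Subsingleton ((B ⧸ J) ⧸ I) := Ideal.Quotient.subsingleton_iff.2 hI
  infer_instance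

lemma finrank_double_quotient_of_functional {I I' : Ideal (B ⧸ J)} (φ : (B ⧸ J) →ₗ[ℂ] ℂ)
    (hI : ∀ x, x ∈ I' ↔ x ∈ I ∧ φ x = 0) {x₀ : B ⧸ J} (hx₀ : x₀ ∈ I) (hφ : φ x₀ ≠ 0)
    (hfin : Module.Finite ℂ ((B ⧸ J) ⧸ I)) :
    Module.Finite ℂ ((B ⧸ J) ⧸ I') ∧
      Module.finrank ℂ ((B ⧸ J) ⧸ I') = Module.finrank ℂ ((B ⧸ J) ⧸ I) + 1 := by
  have E := Submodule.Quotient.restrictScalarsEquiv ℂ I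
  have E' := Submodule.Quotient.restrictScalarsEquiv ℂ I'
  have := Module.Finite.equiv E.symm
  obtain ⟨h1, h2⟩ := finrank_quotient_eq_of_functional (W := I.restrictScalars ℂ)
    (W' := I'.restrictScalars ℂ) φ hI hx₀ hφ
  exact ⟨Module.Finite.equiv E', by rw [← E.finrank_eq, ← E'.finrank_eq, h2]⟩

end DoubleQuotient

/-- The Taylor series of a germ, as a linear map. -/
def germTaylor : holoGerm ℂ →ₗ[ℂ] PowerSeries ℂ where
  toFun φ := Germ.liftOn φ.1 taylorSeries fun _ _ h => taylorSeries.congr h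
  map_add' := by
    rintro ⟨_, F, hF, rfl⟩ ⟨_, G, hG, rfl⟩
    exact taylorSeries.add hF hG
  map_smul' := by
    rintro c ⟨_, F, hF, rfl⟩
    exact taylorSeries.smul c F

lemma order_germTaylor (φ : holoGerm ℂ) : (germTaylor φ).order = germOrder φ := by
  obtain ⟨_, F, hF, rfl⟩ := φ
  exact taylorSeries.order hF

/-! ### Semigroup elements as the jumps of the Hilbert function. -/

namespace PlaneBranch

variable (C : PlaneBranch)

lemma semigroup_eq_valueSet : C.semigroup = valueSet C.n := by
  ext v
  constructor
  · rintro ⟨h, hv⟩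
    obtain ⟨⟨_, F, hF, rfl⟩, rfl⟩ := Ideal.Quotient.mk_surjective h
    exact ⟨F, hF, hv⟩
  · rintro ⟨F, hF, hv⟩
    exact ⟨Ideal.Quotient.mk _ ⟨F, F, hF, rfl⟩, hv⟩

/-- The coefficient of `t ^ ℓ` of the pull-back of a function to the normalization. -/
def coeffNormalization (ℓ : ℕ) : C.LocalAlgebra →ₗ[ℂ] ℂ :=
  (PowerSeries.coeff ℓ) ∘ₗ germTaylor ∘ₗ C.normalization.toLinearMap

lemma val_eq_order (h : C.LocalAlgebra) : C.val h = (germTaylor (C.normalization h)).order :=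
  (order_germTaylor _).symm

lemma coeffNormalization_apply (ℓ : ℕ) (h : C.LocalAlgebra) :
    C.coeffNormalization ℓ h = PowerSeries.coeff ℓ (germTaylor (C.normalization h)) := rfl

lemma mem_filtration {ℓ : ℕ} {h : C.LocalAlgebra} : h ∈ C.filtration ℓ ↔ (ℓ : ℕ∞) ≤ C.val h :=
  Iff.rfl

lemma mem_filtration_succ {ℓ : ℕ} {h : C.LocalAlgebra} :
    h ∈ C.filtration (ℓ + 1) ↔ h ∈ C.filtration ℓ ∧ C.coeffNormalization ℓ h = 0 := by
  rw [mem_filtration, mem_filtration, val_eq_order, coeffNormalization_apply]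
  constructor
  · intro hle
    have hlt : (ℓ : ℕ∞) < (germTaylor (C.normalization h)).order :=
      lt_of_lt_of_le (by exact_mod_cast ℓ.lt_succ_self) hle
    exact ⟨hlt.le, PowerSeries.coeff_of_lt_order _ hlt⟩
  · rintro ⟨hle, hc⟩
    refine PowerSeries.nat_le_order _ _ fun i hi => ?_
    rcases (Nat.lt_succ_iff.1 hi).lt_or_eq with hi | rfl
    · exact PowerSeries.coeff_of_lt_order _ (lt_of_lt_of_le (by exact_mod_cast hi) hle)
    · exact hc

lemma mem_semigroup_iff {ℓ : ℕ} :
    ℓ ∈ C.semigroup ↔ ∃ h ∈ C.filtration ℓ, C.coeffNormalization ℓ h ≠ 0 := by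
  refine exists_congr fun h => ?_
  rw [mem_filtration, val_eq_order, coeffNormalization_apply, PowerSeries.order_eq_nat]
  constructor
  · rintro ⟨h1, h2⟩
    exact ⟨PowerSeries.nat_le_order _ _ h2, h1⟩
  · rintro ⟨h1, h2⟩
    exact ⟨h2, fun i hi => PowerSeries.coeff_of_lt_order _ (lt_of_lt_of_le (by exact_mod_cast hi) h1)⟩

lemma filtration_succ_of_notMem {ℓ : ℕ} (hℓ : ℓ ∉ C.semigroup) :
    C.filtration (ℓ + 1) = C.filtration ℓ := by
  ext h
  rw [mem_filtration_succ, and_iff_left_iff_imp]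
  intro hh
  by_contra hc
  exact hℓ (C.mem_semigroup_iff.2 ⟨h, hh, hc⟩)

/-- Each step of the filtration costs at most one dimension; finiteness is what gives `finrank` its
meaning in `hilbert`. -/
lemma finite_quotient_filtration (ℓ : ℕ) : Module.Finite ℂ (C.LocalAlgebra ⧸ C.filtration ℓ) := by
  induction ℓ with
  | zero =>
    exact finite_quotient_of_eq_top (eq_top_iff.2 fun h _ => C.mem_filtration.2 (by simp))
  | succ ℓ ih =>
    by_cases hℓ : ℓ ∈ C.semigroup
    · obtain ⟨h, hh, hc⟩ := C.mem_semigroup_iff.1 hℓ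
      exact (finrank_double_quotient_of_functional
        (C.coeffNormalization ℓ) (fun _ => C.mem_filtration_succ) hh hc ih).1
    · rwa [C.filtration_succ_of_notMem hℓ]

lemma hilbert_succ_of_mem {ℓ : ℕ} (hℓ : ℓ ∈ C.semigroup) :
    C.hilbert (ℓ + 1) = C.hilbert ℓ + 1 := by
  obtain ⟨h, hh, hc⟩ := C.mem_semigroup_iff.1 hℓ
  exact (finrank_double_quotient_of_functional
    (C.coeffNormalization ℓ) (fun _ => C.mem_filtration_succ) hh hc
    (C.finite_quotient_filtration ℓ)).2

lemma weight_succ_of_mem {ℓ : ℕ} (hℓ : ℓ ∈ C.semigroup) :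
    C.weight (ℓ + 1) = C.weight ℓ + 1 := by
  rw [weight, weight, C.hilbert_succ_of_mem hℓ]
  push_cast
  ring

lemma weight_succ_of_notMem {ℓ : ℕ} (hℓ : ℓ ∉ C.semigroup) :
    C.weight (ℓ + 1) = C.weight ℓ - 1 := by
  rw [weight, weight, hilbert, C.filtration_succ_of_notMem hℓ, ← hilbert]
  push_cast
  ring

end PlaneBranch

end

/-! ### The proposition. -/

theorem mainTheorem4 (C : PlaneBranch) {g : ℕ} (β : Fin (g + 1) → ℕ)
    (hβ : IsMinimalGenerators C.semigroup β)
    (hl : (Finset.univ.gcd fun i : Fin g => β i.castSucc) = 2) :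
    -- the minima `min w₀` and `e = min 𝔑` are attained
    IsLeast (Set.range C.weight) (LatticeCohomology.minWeight C.weight) ∧
    IsLeast (LatticeCohomology.simpleLevels C.weight) (LatticeCohomology.e C.weight) ∧
    -- `ℰ = [0, δ] ∩ 𝒮`
    C.initialPart = Set.Icc 0 C.delta ∩ C.semigroup ∧
    -- `ℍ⁰_{≥ 2e}` is closed under `U` and equals `ℍ⁰`
    (∀ x ∈ LatticeCohomology.geq C.weight (LatticeCohomology.e C.weight),
      (Polynomial.X : Polynomial ℤ) • x ∈
        LatticeCohomology.geq C.weight (LatticeCohomology.e C.weight)) ∧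
    LatticeCohomology.geq C.weight (LatticeCohomology.e C.weight) = ⊤ ∧
    -- `min w₀ ∈ 𝔑`
    LatticeCohomology.minWeight C.weight ∈ LatticeCohomology.simpleLevels C.weight := by
  have hS := C.semigroup_eq_valueSet
  obtain ⟨p, hodd, heven⟩ :=
    exists_even_below_above C.analytic_n C.map_zero_n C.injective_n (hS ▸ hβ) hl
  rw [← hS] at hodd heven
  have hnot := fun l => C.weight_succ_of_notMem (ℓ := l)
  have hmem := fun l => C.weight_succ_of_mem (ℓ := l)
  have hbdd := LatticeCohomology.bddBelow_of_semigroup hnot hmem hodd heven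
  have huni := LatticeCohomology.almostUnimodal_of_semigroup hnot hmem hodd heven
  have hmin := LatticeCohomology.isLeast_minWeight hbdd
  have htop := LatticeCohomology.geq_minWeight hbdd
  refine ⟨hmin, ?_, ?_, ?_, ?_, huni.minWeight_mem_simpleLevels⟩
  · rw [huni.e_eq_minWeight]
    exact huni.isLeast_simpleLevels
  · rw [PlaneBranch.initialPart, huni.e_eq_minWeight]
    ext s
    -- With `e = min w₀` the condition `w(s) ≥ e` is vacuous.
    exact ⟨fun ⟨h1, _, h3⟩ => ⟨⟨Nat.zero_le s, h3⟩, h1⟩,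
      fun ⟨h1, h2⟩ => ⟨h2, hmin.2 ⟨s, rfl⟩, h1.2⟩⟩
  · rw [huni.e_eq_minWeight, htop]
    exact fun _ _ => AddSubgroup.mem_top _
  · rw [huni.e_eq_minWeight, htop]
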